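/- **Setting.** Let $D\ge 1$, let $\mathbb T^D=\{|\zeta_1|=\dots=|\zeta_D|=1\}$ be the unit torus, and let $d\boldsymbol\theta=d\theta_1\cdots d\theta_D$ be the Lebesgue–Haar measure on it (total mass $(2\pi)^D$). Let $d\mu=\hat\mu\,d\boldsymbol\theta$ be an absolutely continuous complex measure on $\mathbb T^D$ with integrable density $\hat\mu:\mathbb T^D\to\mathbb C$, and $d\bar\mu=\overline{\hat\mu}\,d\boldsymbol\theta$. For $\boldsymbol\alpha\in\mathbb Z^D$ put $\boldsymbol z^{\boldsymbol\alpha}=z_1^{\alpha_1}\cdots z_D^{\alpha_D}$ and $|\boldsymbol\alpha|=\sum_i|\alpha_i|$. The moment matrix is $G_{\boldsymbol\alpha,\boldsymbol\beta}=\oint_{\mathbb T^D}e^{\mathrm i(\boldsymbol\alpha-\boldsymbol\beta)\cdot\boldsymbol\theta}\,d\mu(\boldsymbol\theta)$, with rows and columns indexed by $\mathbb Z^D$ and arranged in blocks according to $|\boldsymbol\alpha|$ and $|\boldsymbol\beta|$. Assume that $\mu$ is quasi-definite: for every $k\ge0$ the finite matrix $(G_{\boldsymbol\alpha,\boldsymbol\beta})_{|\boldsymbol\alpha|,|\boldsymbol\beta|<k}$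 is non-singular. Then there is exactly one block Gauss–Borel factorization $G=S^{-1}H(\hat S^{-1})^\dagger$ with $S,\hat S$ lower block triangular with identity diagonal blocks and $H$ block diagonal; the biorthogonal Laurent polynomials are $\Phi_{\boldsymbol\alpha}(\boldsymbol z)=\sum_{\boldsymbol\beta}S_{\boldsymbol\alpha,\boldsymbol\beta}\boldsymbol z^{\boldsymbol\beta}$ and $\hat\Phi_{\boldsymbol\alpha}(\boldsymbol z)=\sum_{\boldsymbol\beta}\hat S_{\boldsymbol\alpha,\boldsymbol\beta}\boldsymbol z^{\boldsymbol\beta}$. For $\sigma\subseteq\{1,\dots,D\}$ with complement $\complement\sigma$ let $\partial\sigma=\{i\in\sigma: i+1\notin\sigma\}$ (indices modulo $D$), and let $(\mathbb D^D)_\sigma$ be the set of $\boldsymbol z\in\mathbb C^D$ with $|z_i|>1$ for $i\in\sigma$ and $|z_i|<1$ for $i\in\complement\sigma$. For $\sigma\ne\{1,\dots,D\}$ the integer orthant $(\mathbb Z^D)_\sigma$ is the set of $\boldsymbol\alpha\in\mathbb Z^D$ with $\alpha_i\le0$ for $i\in\sigma\setminus\partial\sigma$, $\alpha_i<0$ for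 $i\in\partial\sigma$, $\alpha_i\ge0$ for $i\in\complement\sigma\setminus\partial\complement\sigma$, and $\alpha_i>0$ for $i\in\partial\complement\sigma$; for $\sigma=\{1,\dots,D\}$ it is $\{\boldsymbol\alpha\ne\boldsymbol 0:\alpha_i\le0\ \forall i\}$. The Cauchy–Mohammed kernel is $$C_\sigma(\boldsymbol z,\boldsymbol\zeta)=\sum_{\boldsymbol\alpha\in(\mathbb Z^D)_\sigma}\overline{\boldsymbol\zeta^{\boldsymbol\alpha}}\,\boldsymbol z^{\boldsymbol\alpha},\qquad \boldsymbol z\in(\mathbb D^D)_\sigma,\ \boldsymbol\zeta\in\mathbb T^D .$$ For a continuous $f:\mathbb T^D\to\mathbb C$ with Fourier coefficients $c_{\boldsymbol\alpha}(f)=(2\pi)^{-D}\oint_{\mathbb T^D} f(e^{\mathrm i\boldsymbol\theta})e^{-\mathrm i\boldsymbol\alpha\cdot\boldsymbol\theta}\,d\boldsymbol\theta$ let $f^{[\sigma]}(\boldsymbol z)=\sum_{\boldsymbol\alpha\in(\mathbb Z^D)_\sigma}c_{\boldsymbol\alpha}(f)\,\boldsymbol z^{\boldsymbol\alpha}$ for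 $\boldsymbol z\in(\mathbb D^D)_\sigma$, and for $\boldsymbol\zeta\in\mathbb T^D$ let $f^{[\sigma]}(\boldsymbol\zeta)$ denote the boundary value $\lim_{(\mathbb D^D)_\sigma\ni\boldsymbol z\to\boldsymbol\zeta}f^{[\sigma]}(\boldsymbol z)$, when this limit exists. **Theorem (Plemej formulæ).** Let $\boldsymbol\alpha\in\mathbb Z^D$ and suppose that $\Phi_{\boldsymbol\alpha}\hat\mu$ and $\hat\Phi_{\boldsymbol\alpha}\overline{\hat\mu}$ are Hölder continuous on $\mathbb T^D$ with an exponent in $(0,1)$. Then, for $f=\hat\Phi_{\boldsymbol\alpha}\overline{\hat\mu}$ and for $f=\Phi_{\boldsymbol\alpha}\hat\mu$ and for every $\sigma\subseteq\{1,\dots,D\}$, the function $f^{[\sigma]}$ is holomorphic in $(\mathbb D^D)_\sigma$ and has a boundary value at every point of $\mathbb T^D$; all the limits below exist (as unrestricted limits inside the indicated polydomain); and for all $\boldsymbol\zeta\in\mathbb T^D$ and all $\sigma$ $$\lim_{\substack{\boldsymbol z\in(\mathbb D^D)_\sigma\\ \boldsymbol z\to\boldsymbol\zeta}}\oint_{\mathbb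 T^D}\hat\Phi_{\boldsymbol\alpha}(e^{\mathrm i\boldsymbol\theta})C_\sigma(\boldsymbol z,e^{\mathrm i\boldsymbol\theta})\,d\bar\mu(\boldsymbol\theta)+\lim_{\substack{\boldsymbol z\in(\mathbb D^D)_{\complement\sigma}\\ \boldsymbol z\to\boldsymbol\zeta}}\oint_{\mathbb T^D}\hat\Phi_{\boldsymbol\alpha}(e^{\mathrm i\boldsymbol\theta})C_{\complement\sigma}(\boldsymbol z,e^{\mathrm i\boldsymbol\theta})\,d\bar\mu(\boldsymbol\theta)=(2\pi)^D\Big(\big(\hat\Phi_{\boldsymbol\alpha}\overline{\hat\mu}\big)^{[\sigma]}(\boldsymbol\zeta)+\big(\hat\Phi_{\boldsymbol\alpha}\overline{\hat\mu}\big)^{[\complement\sigma]}(\boldsymbol\zeta)\Big),$$ $$\lim_{\substack{\boldsymbol z\in(\mathbb D^D)_\sigma\\ \boldsymbol z\to\boldsymbol\zeta}}\oint_{\mathbb T^D}\Phi_{\boldsymbol\alpha}(e^{\mathrm i\boldsymbol\theta})C_\sigma(\boldsymbol z,e^{\mathrm i\boldsymbol\theta})\,d\mu(\boldsymbol\theta)+\lim_{\substack{\boldsymbol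 z\in(\mathbb D^D)_{\complement\sigma}\\ \boldsymbol z\to\boldsymbol\zeta}}\oint_{\mathbb T^D}\Phi_{\boldsymbol\alpha}(e^{\mathrm i\boldsymbol\theta})C_{\complement\sigma}(\boldsymbol z,e^{\mathrm i\boldsymbol\theta})\,d\mu(\boldsymbol\theta)=(2\pi)^D\Big(\big(\Phi_{\boldsymbol\alpha}\hat\mu\big)^{[\sigma]}(\boldsymbol\zeta)+\big(\Phi_{\boldsymbol\alpha}\hat\mu\big)^{[\complement\sigma]}(\boldsymbol\zeta)\Big).$$ Moreover, $$\sum_{\sigma\subseteq\{1,\dots,D\}}\ \lim_{\substack{\boldsymbol z\in(\mathbb D^D)_\sigma\\ \boldsymbol z\to\boldsymbol\zeta}}\oint_{\mathbb T^D}\hat\Phi_{\boldsymbol\alpha}(e^{\mathrm i\boldsymbol\theta})C_\sigma(\boldsymbol z,e^{\mathrm i\boldsymbol\theta})\,d\bar\mu(\boldsymbol\theta)=(2\pi)^D\,\hat\Phi_{\boldsymbol\alpha}(\boldsymbol\zeta)\overline{\hat\mu(\boldsymbol\zeta)},$$ $$\sum_{\sigma\subseteq\{1,\dots,D\}}\ \lim_{\substack{\boldsymbol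 z\in(\mathbb D^D)_\sigma\\ \boldsymbol z\to\boldsymbol\zeta}}\oint_{\mathbb T^D}\Phi_{\boldsymbol\alpha}(e^{\mathrm i\boldsymbol\theta})C_\sigma(\boldsymbol z,e^{\mathrm i\boldsymbol\theta})\,d\mu(\boldsymbol\theta)=(2\pi)^D\,\Phi_{\boldsymbol\alpha}(\boldsymbol\zeta)\hat\mu(\boldsymbol\zeta).$$ -/

import Mathlib

open Filter Topology
open scoped NNReal ComplexConjugate Matrix

namespace MVOLPUT

noncomputable section

/-! ### The unit torus and its Lebesgue-Haar measure of total mass `(2π)^D` -/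

/-- The unit torus `𝕋^D`, as a type. -/
abbrev Torus (D : ℕ) : Type := Fin D → Circle

/-- The inclusion `𝕋^D ⊆ ℂ^D`. -/
def toC {D : ℕ} (ζ : Torus D) : Fin D → ℂ := fun i => (ζ i : ℂ)

/-- The parametrization `θ ↦ (e^{iθ₁}, …, e^{iθ_D})`. -/
def expTorus {D : ℕ} (θ : Fin D → ℝ) : Torus D := fun i => Circle.exp (θ i)

/-- The cube of angles `[0, 2π)^D`. -/
def angleBox (D : ℕ) : Set (Fin D → ℝ) :=
  Set.pi Set.univ fun _ => Set.Ico 0 (2 * Real.pi)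

/-- `∮_{𝕋^D} f(e^{iθ}) dθ`, with `dθ = dθ₁ ⋯ dθ_D`. -/
def oint {D : ℕ} (f : Torus D → ℂ) : ℂ :=
  ∫ θ in angleBox D, f (expTorus θ)

/-- `w` is the density of a complex measure `dμ(θ) = w(e^{iθ}) dθ` on the torus. -/
def IsDensity {D : ℕ} (w : Torus D → ℂ) : Prop :=
  MeasureTheory.IntegrableOn (fun θ => w (expTorus θ)) (angleBox D)

/-! ### Laurent monomials and the longitude -/

/-- The Laurent monomial `z^α = z₁^{α₁} ⋯ z_D^{α_D}`. -/
def mono {D : ℕ} (z : Fin D → ℂ) (α : Fin D → ℤ) : ℂ := ∏ i, z i ^ α i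

/-- The longitude `|α| = |α₁| + ⋯ + |α_D|`. -/
def longitude {D : ℕ} (α : Fin D → ℤ) : ℕ := ∑ i, (α i).natAbs

/-- The finite set of multi-indices of longitude less than `k`. -/
def multiIndicesLT (D k : ℕ) : Finset (Fin D → ℤ) :=
  (Fintype.piFinset fun _ => Finset.Icc (-(k : ℤ)) k).filter fun α => longitude α < k

theorem mem_multiIndicesLT {D k : ℕ} {α : Fin D → ℤ} :
    α ∈ multiIndicesLT D k ↔ longitude α < k := by
  unfold multiIndicesLT
  rw [Finset.mem_filter, and_iff_right_iff_imp]
  intro h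
  rw [Fintype.mem_piFinset]
  intro i
  have : (α i).natAbs ≤ longitude α :=
    Finset.single_le_sum (f := fun i => (α i).natAbs) (fun _ _ => Nat.zero_le _)
      (Finset.mem_univ i)
  rw [Finset.mem_Icc]
  omega

/-! ### The moment matrix and its block Gauss-Borel factorization

Semi-infinite matrices have rows and columns labelled by the multi-indices `α ∈ ℤ^D`; the block
`A_{[k],[l]}` consists of the entries `A α β` with `|α| = k` and `|β| = l`. (The order in which the
multi-indices of one and the same longitude are listed plays no role for the block structure.) -/

/-- Semi-infinite matrices. -/
abbrev SemiInf (D : ℕ) : Type := Matrix (Fin D → ℤ) (Fin D → ℤ) ℂ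

/-- The product of two semi-infinite matrices. It is used only where each entry is a finite sum,
because the left factor has finite rows or the right factor has finite columns. -/
def mulInf {D : ℕ} (A B : SemiInf D) : SemiInf D :=
  Matrix.of fun α β => ∑ᶠ γ, A α γ * B γ β

/-- The moment matrix `G_{α,β} = ∮ e^{i(α-β)·θ} dμ(θ)` of the measure `dμ = w dθ`. -/
def momentMatrix {D : ℕ} (w : Torus D → ℂ) : SemiInf D :=
  Matrix.of fun α β => oint fun ζ => mono (toC ζ) (α - β) * w ζ

/-- The truncation `G^{[k]}`, formed by the blocks `G_{[i],[j]}` with `i, j < k`. -/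
def truncation {D : ℕ} (G : SemiInf D) (k : ℕ) :
    Matrix (multiIndicesLT D k) (multiIndicesLT D k) ℂ :=
  G.submatrix Subtype.val Subtype.val

/-- All principal block minors `det G^{[k]}` are non-zero. -/
def IsQuasiDefinite {D : ℕ} (G : SemiInf D) : Prop := ∀ k : ℕ, (truncation G k).det ≠ 0

/-- Lower block unitriangular matrices: the diagonal blocks are identity matrices and the
blocks above the diagonal vanish. -/
def IsLowerUnitriangular {D : ℕ} (S : SemiInf D) : Prop :=
  ∀ α β, longitude α ≤ longitude β → S α β = if α = β then 1 else 0

/-- Block diagonal matrices. -/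
def IsBlockDiagonal {D : ℕ} (H : SemiInf D) : Prop :=
  ∀ α β, longitude α ≠ longitude β → H α β = 0

/-- `(S, H, Ŝ)` is the block Gauss-Borel factorization `G = S⁻¹ H (Ŝ⁻¹)†`, that is `S G Ŝ† = H`,
with `S`, `Ŝ` lower block unitriangular and `H` block diagonal. -/
structure IsGaussBorel {D : ℕ} (G S H Sh : SemiInf D) : Prop where
  lower : IsLowerUnitriangular S
  lower_hat : IsLowerUnitriangular Sh
  diagonal : IsBlockDiagonal H
  factorization : mulInf (mulInf S G) Shᴴ = H

section GaussBorel

variable {D : ℕ}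

theorem IsLowerUnitriangular.mulInf_apply {S : SemiInf D} (hS : IsLowerUnitriangular S)
    (B : SemiInf D) (α β : Fin D → ℤ) :
    mulInf S B α β = B α β + ∑ γ ∈ multiIndicesLT D (longitude α), S α γ * B γ β := by
  have hα : α ∉ multiIndicesLT D (longitude α) := by simp [mem_multiIndicesLT]
  have key : mulInf S B α β =
      ∑ γ ∈ insert α (multiIndicesLT D (longitude α)), S α γ * B γ β := by
    refine finsum_eq_finsetSum_of_support_subset _ ?_
    intro γ hγ
    by_contra hn
    rw [Finset.mem_coe, Finset.mem_insert, mem_multiIndicesLT, not_or, not_lt] at hn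
    apply hγ
    simp [hS α γ hn.2, Ne.symm hn.1]
  rw [key, Finset.sum_insert hα, hS α α le_rfl]
  simp

theorem mulInf_conjTranspose (A B : SemiInf D) : mulInf A Bᴴ = (mulInf B Aᴴ)ᴴ := by
  ext α β
  simp only [mulInf, Matrix.conjTranspose_apply]
  have h := (starRingEnd ℂ).toAddMonoidHom.map_finsum_of_injective
    (star_injective (R := ℂ)) (fun γ => B β γ * star (A α γ))
  refine Eq.trans ?_ h.symm
  refine finsum_congr fun γ => ?_
  simp [mul_comm]

theorem mulInf_assoc_of_lower {S Sh : SemiInf D} (hS : IsLowerUnitriangular S)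
    (hSh : IsLowerUnitriangular Sh) (G : SemiInf D) :
    mulInf (mulInf S G) Shᴴ = mulInf S (mulInf G Shᴴ) := by
  ext α β
  rw [hS.mulInf_apply, mulInf_conjTranspose, Matrix.conjTranspose_apply, hSh.mulInf_apply]
  simp only [Matrix.conjTranspose_apply, mulInf_conjTranspose G Sh, hSh.mulInf_apply,
    hS.mulInf_apply, star_add, star_sum, star_mul', star_star, mul_add, Finset.sum_add_distrib,
    Finset.mul_sum]
  rw [Finset.sum_comm]
  have h : ∀ x y : Fin D → ℤ, star (Sh β y) * (S α x * G x y) = S α x * (star (Sh β y) * G x y) :=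
    fun x y => by ring
  simp only [h]
  ring

/-- `S` has the left orthogonality property of the factor `S` in a Gauss-Borel factorization. -/
theorem existsUnique_lower {G : SemiInf D} (hG : IsQuasiDefinite G) :
    ∃! S : SemiInf D, IsLowerUnitriangular S ∧
      ∀ α β, longitude β < longitude α → mulInf S G α β = 0 := by
  classical
  obtain ⟨T, hT⟩ : ∃ T : SemiInf D, ∀ α γ, T α γ = if α = γ then 1 else
      if h : longitude γ < longitude α then
        -∑ δ : multiIndicesLT D (longitude α), G α δ *
          (truncation G (longitude α))⁻¹ δ ⟨γ, mem_multiIndicesLT.2 h⟩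
      else 0 := ⟨Matrix.of fun _ _ => _, fun _ _ => rfl⟩
  have hTl : IsLowerUnitriangular T := by
    intro α β h
    rw [hT]
    simp [not_lt.2 h]
  refine ⟨T, ⟨hTl, ?_⟩, ?_⟩
  · intro α β h
    rw [hTl.mulInf_apply, ← Finset.sum_coe_sort]
    simp only [hT]
    have hu : IsUnit (truncation G (longitude α)).det := isUnit_iff_ne_zero.2 (hG _)
    have e : ∀ γ : multiIndicesLT D (longitude α), (α = γ.1) = False := fun γ => by
      have := mem_multiIndicesLT.1 γ.2
      simp only [eq_iff_iff, iff_false]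
      rintro h'
      rw [← h'] at this
      exact lt_irrefl _ this
    have e' : ∀ γ : multiIndicesLT D (longitude α), longitude γ.1 < longitude α :=
      fun γ => mem_multiIndicesLT.1 γ.2
    simp only [e, e', if_false, dif_pos, Subtype.coe_eta, neg_mul, Finset.sum_neg_distrib,
      Finset.sum_mul]
    rw [Finset.sum_comm]
    have h2 : ∀ δ : multiIndicesLT D (longitude α),
        ∑ γ : multiIndicesLT D (longitude α),
          (truncation G (longitude α))⁻¹ δ γ * G γ β =
        if δ = ⟨β, mem_multiIndicesLT.2 h⟩ then 1 else 0 := by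
      intro δ
      have := congrFun (congrFun (Matrix.nonsing_inv_mul _ hu) δ)
        (⟨β, mem_multiIndicesLT.2 h⟩ : multiIndicesLT D (longitude α))
      rw [Matrix.one_apply] at this
      rw [← this]
      rfl
    simp only [mul_assoc, ← Finset.mul_sum, h2]
    simp
  · rintro S ⟨hS, h0⟩
    ext α γ
    by_cases hαγ : α = γ
    · subst hαγ
      rw [hS α α le_rfl, hTl α α le_rfl]
    by_cases h : longitude γ < longitude α
    swap
    · rw [hT, if_neg hαγ, dif_neg h, hS α γ (not_lt.1 h), if_neg hαγ]
    have hu : IsUnit (truncation G (longitude α)).det := isUnit_iff_ne_zero.2 (hG _)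
    rw [hT, if_neg hαγ, dif_pos h]
    have h1 : Matrix.vecMul (fun γ : multiIndicesLT D (longitude α) => S α γ)
        (truncation G (longitude α)) =
        fun β : multiIndicesLT D (longitude α) => -G α β.1 := by
      funext β
      have := h0 α β (mem_multiIndicesLT.1 β.2)
      rw [hS.mulInf_apply, ← Finset.sum_coe_sort] at this
      exact eq_neg_of_add_eq_zero_right this
    have h2 := congrArg (fun v => Matrix.vecMul v (truncation G (longitude α))⁻¹) h1
    simp only [Matrix.vecMul_vecMul, Matrix.mul_nonsing_inv _ hu, Matrix.vecMul_one] at h2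
    have h3 := congrFun h2 ⟨γ, mem_multiIndicesLT.2 h⟩
    simp only at h3
    rw [h3]
    simp [Matrix.vecMul, dotProduct]

theorem IsQuasiDefinite.conjTranspose {G : SemiInf D} (hG : IsQuasiDefinite G) :
    IsQuasiDefinite Gᴴ := by
  intro k
  have : truncation Gᴴ k = (truncation G k)ᴴ := rfl
  rw [this, Matrix.det_conjTranspose]
  exact star_ne_zero.2 (hG k)

theorem isGaussBorel_iff {G S H Sh : SemiInf D} :
    IsGaussBorel G S H Sh ↔
      (IsLowerUnitriangular S ∧ ∀ α β, longitude β < longitude α → mulInf S G α β = 0) ∧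
      (IsLowerUnitriangular Sh ∧ ∀ α β, longitude β < longitude α → mulInf Sh Gᴴ α β = 0) ∧
      H = mulInf (mulInf S G) Shᴴ := by
  have main : ∀ {S Sh G : SemiInf D}, IsLowerUnitriangular Sh →
      ((∀ α β, longitude β < longitude α → mulInf S G α β = 0) ↔
       (∀ α β, longitude β < longitude α → mulInf (mulInf S G) Shᴴ α β = 0)) := by
    intro S Sh G hSh
    have e : ∀ α β, mulInf (mulInf S G) Shᴴ α β = mulInf S G α β +
        ∑ γ ∈ multiIndicesLT D (longitude β), mulInf S G α γ * star (Sh β γ) := by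
      intro α β
      rw [mulInf_conjTranspose, Matrix.conjTranspose_apply, hSh.mulInf_apply]
      simp [mul_comm]
    constructor
    · intro h α β hβ
      rw [e, h α β hβ, Finset.sum_eq_zero, add_zero]
      intro γ hγ
      rw [h α γ ((mem_multiIndicesLT.1 hγ).trans hβ), zero_mul]
    · intro h α
      suffices ∀ n, ∀ β, longitude β = n → longitude β < longitude α → mulInf S G α β = 0 from
        fun β => this _ β rfl
      intro n
      induction n using Nat.strong_induction_on with
      | _ n ih =>
        intro β hn hβ
        have h1 := h α β hβ
        rw [e, Finset.sum_eq_zero, add_zero] at h1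
        · exact h1
        · intro γ hγ
          have hγ' := mem_multiIndicesLT.1 hγ
          rw [ih _ (hn ▸ hγ') γ rfl (hγ'.trans hβ), zero_mul]
  have flip : ∀ {S Sh : SemiInf D}, IsLowerUnitriangular S → IsLowerUnitriangular Sh →
      mulInf (mulInf S G) Shᴴ = (mulInf (mulInf Sh Gᴴ) Sᴴ)ᴴ := by
    intro S Sh hS hSh
    rw [mulInf_assoc_of_lower hS hSh, mulInf_conjTranspose (mulInf Sh Gᴴ) S,
      Matrix.conjTranspose_conjTranspose, mulInf_conjTranspose G Sh]
  constructor
  · rintro ⟨hS, hSh, hd, hf⟩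
    refine ⟨⟨hS, (main hSh).2 ?_⟩, ⟨hSh, (main hS).2 ?_⟩, hf.symm⟩
    · intro α β h
      rw [hf]
      exact hd α β h.ne'
    · intro α β h
      rw [flip hS hSh] at hf
      have := hd β α h.ne
      rw [← hf, Matrix.conjTranspose_apply] at this
      exact star_eq_zero.1 this
  · rintro ⟨⟨hS, h1⟩, ⟨hSh, h2⟩, rfl⟩
    refine ⟨hS, hSh, fun α β h => ?_, rfl⟩
    rcases lt_or_gt_of_ne h with h | h
    · rw [flip hS hSh, Matrix.conjTranspose_apply, (main hS).1 h2 β α h, star_zero]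
    · exact (main hSh).1 h1 α β h

/-- A quasi-definite matrix has exactly one block Gauss-Borel factorization. -/
theorem existsUnique_gaussBorel {G : SemiInf D} (hG : IsQuasiDefinite G) :
    ∃! T : SemiInf D × SemiInf D × SemiInf D, IsGaussBorel G T.1 T.2.1 T.2.2 := by
  obtain ⟨S, hS, hS'⟩ := existsUnique_lower hG
  obtain ⟨Sh, hSh, hSh'⟩ := existsUnique_lower hG.conjTranspose
  refine ⟨(S, mulInf (mulInf S G) Shᴴ, Sh), isGaussBorel_iff.2 ⟨hS, hSh, rfl⟩, ?_⟩
  rintro ⟨S₁, H₁, Sh₁⟩ h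
  obtain ⟨h1, h2, h3⟩ := isGaussBorel_iff.1 h
  obtain rfl := hS' _ h1
  obtain rfl := hSh' _ h2
  exact Prod.ext rfl (Prod.ext h3 rfl)

end GaussBorel

/-- The factor `S` of the Gauss-Borel factorization. -/
def factorS {D : ℕ} {G : SemiInf D} (hG : IsQuasiDefinite G) : SemiInf D :=
  (existsUnique_gaussBorel hG).choose.1

/-- The factor `Ŝ` of the Gauss-Borel factorization. -/
def factorSh {D : ℕ} {G : SemiInf D} (hG : IsQuasiDefinite G) : SemiInf D :=
  (existsUnique_gaussBorel hG).choose.2.2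

/-- The biorthogonal Laurent polynomials `Φ = S χ`: the component `Φ_α`. -/
def Phi {D : ℕ} {G : SemiInf D} (hG : IsQuasiDefinite G) (α : Fin D → ℤ) (z : Fin D → ℂ) : ℂ :=
  ∑ᶠ β, factorS hG α β * mono z β

/-- The biorthogonal Laurent polynomials `Φ̂ = Ŝ χ`: the component `Φ̂_α`. -/
def PhiHat {D : ℕ} {G : SemiInf D} (hG : IsQuasiDefinite G) (α : Fin D → ℤ) (z : Fin D → ℂ) : ℂ :=
  ∑ᶠ β, factorSh hG α β * mono z β

/-! ### Orthants, Cauchy-Mohammed kernels, holomorphic orthant extensions -/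

/-- The right boundary `∂σ = {i ∈ σ : i + 1 ∉ σ}`; the successor `i + 1` is cyclic. -/
def rightBoundary {D : ℕ} [NeZero D] (σ : Finset (Fin D)) : Finset (Fin D) :=
  σ.filter fun i => i + 1 ∉ σ

/-- The orthant polydisk `(𝔻^D)_σ`: `|z_i| > 1` for `i ∈ σ` and `|z_i| < 1` for `i ∉ σ`. -/
def polydisk {D : ℕ} (σ : Finset (Fin D)) : Set (Fin D → ℂ) :=
  {z | ∀ i, if i ∈ σ then 1 < ‖z i‖ else ‖z i‖ < 1}

/-- The integer orthant `(ℤ^D)_σ`. -/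
def orthant {D : ℕ} [NeZero D] (σ : Finset (Fin D)) : Set (Fin D → ℤ) :=
  if σ = Finset.univ then {α | (∀ i, α i ≤ 0) ∧ α ≠ 0}
  else {α | (∀ i ∈ σ \ rightBoundary σ, α i ≤ 0) ∧ (∀ i ∈ rightBoundary σ, α i < 0) ∧
    (∀ i ∈ σᶜ \ rightBoundary σᶜ, 0 ≤ α i) ∧ (∀ i ∈ rightBoundary σᶜ, 0 < α i)}

/-- The Fourier orthant vector `χ_σ(z)`. -/
def chiOrthant {D : ℕ} [NeZero D] (σ : Finset (Fin D)) (z : Fin D → ℂ) (α : Fin D → ℤ) : ℂ :=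
  (orthant σ).indicator (mono z) α

/-- The Cauchy-Mohammed kernel `C_σ(z, ζ) = χ(ζ)† χ_σ(z) = ∑_{α ∈ (ℤ^D)_σ} conj(ζ^α) z^α`, for
`z ∈ (𝔻^D)_σ` and `ζ ∈ 𝕋^D`. -/
def cauchyKernel {D : ℕ} [NeZero D] (σ : Finset (Fin D)) (z : Fin D → ℂ) (ζ : Torus D) : ℂ :=
  ∑' α : Fin D → ℤ, conj (mono (toC ζ) α) * chiOrthant σ z α

/-- The Fourier coefficients `(2π)^{-D} ∮ f(e^{iθ}) e^{-iα·θ} dθ`. -/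
def fourierCoefficient {D : ℕ} (f : Torus D → ℂ) (α : Fin D → ℤ) : ℂ :=
  ((2 * Real.pi : ℂ) ^ D)⁻¹ * oint fun ζ => f ζ * mono (toC ζ) (-α)

/-- The holomorphic function `f^{[σ]}` on `(𝔻^D)_σ` obtained from the Fourier series of `f` by
disregarding the multi-indices that are not in `(ℤ^D)_σ`. -/
def orthantExtension {D : ℕ} [NeZero D] (f : Torus D → ℂ) (σ : Finset (Fin D))
    (z : Fin D → ℂ) : ℂ :=
  ∑' α : Fin D → ℤ, fourierCoefficient f α * chiOrthant σ z α

end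

end MVOLPUT

/-! # Plemelj formulae on the torus

Boundary limits of Cauchy-Mohammed integrals of Hölder continuous functions. -/

namespace MVOLPUT

noncomputable section

open MeasureTheory

/-! ### Arc length on the circle -/

/-! Both halves are one statement about a Hölder function `f` on the torus (`plemelj_formulae`).
Integrating the kernel series termwise gives f^{[σ]}(z) = (2π)^{-D} ∮ f C_σ(z, ·)
(`orthantExtension_eq`). Hence the formula for σ and its complement follows as soon as the boundary
limits exist, and holomorphy is differentiation under the integral sign.

Existence of the limits. The kernel is a product of one-variable geometric sums, minus 1 when σ is
everything. Rotating the variable by the arguments of z puts all singularities at η = 1 and leaves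
kernels K_i(η_i) depending only on |z_i|, with |K_i(η)| |η - 1| ≤ 2 and an integral independent of
z. The remaining factor is a rotate of `f`, with the same Hölder bounds. Now peel off one variable
by F(η, ·) = F(1, ·) + (F(η, ·) - F(1, ·)). The first term contributes the constant integral of K_0.
The difference is Hölder of exponent r/2 with norm O(|η - 1|^{r/2})
(`IsHolderBounded.cons_sub_cons`), so the outer integrand is O(|η - 1|^{r/2-1}) uniformly in z, and
dominated convergence applies. Induction on the dimension gives `exists_tendsto_integral_mul_prod`.

Sum over σ. The integer orthants partition ℤ^D (`existsUnique_mem_orthant`). At the points with z_i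
= ρ^{±1} ζ_i the kernels therefore add up to a product of Poisson kernels. These tend to 0 off η = 1
and have integral 2π, so the same limit lemma yields (2π)^D f(ζ). Since the unrestricted limits
exist, they may be evaluated along this radial approach. -/

instance : MeasurableSpace Circle := borel Circle

instance : BorelSpace Circle := ⟨rfl⟩

instance : Fact (0 < 2 * Real.pi) := ⟨Real.two_pi_pos⟩

theorem circle_dist_eq (a b : Circle) : dist a b = ‖(a : ℂ) - b‖ :=
  dist_eq_norm (a : ℂ) b

theorem circle_dist_le_two (a b : Circle) : dist a b ≤ 2 := by
  rw [circle_dist_eq]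
  calc ‖(a : ℂ) - b‖ ≤ ‖(a : ℂ)‖ + ‖(b : ℂ)‖ := norm_sub_le _ _
    _ = 2 := by rw [Circle.norm_coe, Circle.norm_coe]; norm_num

/-- Arc length on the unit circle, of total mass `2π`. -/
def arcMeasure : Measure Circle :=
  Measure.map AddCircle.homeomorphCircle' (volume : Measure (AddCircle (2 * Real.pi)))

/-- The starting angle is free because 0 matches `angleBox`, while -π centres the interval on the
singularity at 1. -/
theorem measurePreserving_circleExp (t : ℝ) :
    MeasurePreserving Circle.exp (volume.restrict (Set.Ioc t (t + 2 * Real.pi))) arcMeasure := by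
  have h1 := AddCircle.measurePreserving_mk (2 * Real.pi) t
  have h2 : MeasurePreserving AddCircle.homeomorphCircle'
      (volume : Measure (AddCircle (2 * Real.pi))) arcMeasure :=
    ⟨AddCircle.homeomorphCircle'.continuous.measurable, rfl⟩
  exact h2.comp h1

instance : IsFiniteMeasure arcMeasure := by
  unfold arcMeasure
  infer_instance

instance : arcMeasure.IsMulLeftInvariant := by
  refine ⟨fun a => ?_⟩
  obtain ⟨s, rfl⟩ := AddCircle.homeomorphCircle'.surjective a
  have hc := AddCircle.homeomorphCircle'.continuous.measurable
  unfold arcMeasure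
  rw [Measure.map_map (by fun_prop) hc]
  have : (fun x => AddCircle.homeomorphCircle' s * x) ∘ AddCircle.homeomorphCircle' =
      AddCircle.homeomorphCircle' ∘ fun x => s + x := by
    funext x
    induction s using QuotientAddGroup.induction_on with | _ s => ?_
    induction x using QuotientAddGroup.induction_on with | _ x => ?_
    -- On classes of reals the homeomorphism is `Circle.exp` by definition.
    exact (Circle.exp_add s x).symm
  rw [this, ← Measure.map_map hc (by fun_prop), map_add_left_eq_self]

/-- The product measure on the torus, of total mass `(2π)^D`. -/
def torusMeasure (D : ℕ) : Measure (Torus D) := Measure.pi fun _ => arcMeasure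

instance (D : ℕ) : IsFiniteMeasure (torusMeasure D) := by
  unfold torusMeasure
  infer_instance

instance (D : ℕ) : (torusMeasure D).IsMulLeftInvariant := by
  unfold torusMeasure
  infer_instance

/-- Replaces the box of angles by an invariant measure on the group, for which rotations are
legitimate substitutions. -/
theorem oint_eq_integral {D : ℕ} {f : Torus D → ℂ}
    (hf : AEStronglyMeasurable f (torusMeasure D)) :
    oint f = ∫ ζ, f ζ ∂torusMeasure D := by
  have hm : MeasurePreserving (expTorus (D := D)) (volume.restrict (angleBox D))
      (torusMeasure D) := by
    unfold angleBox
    rw [volume_pi, Measure.restrict_pi_pi]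
    refine measurePreserving_pi (fun _ : Fin D => volume.restrict (Set.Ico 0 (2 * Real.pi)))
      (fun _ => arcMeasure) fun _ => ?_
    have := measurePreserving_circleExp 0
    rwa [zero_add, ← Measure.restrict_congr_set Ico_ae_eq_Ioc] at this
  rw [← hm.map_eq, integral_map hm.measurable.aemeasurable (by rwa [hm.map_eq]), oint]

theorem arcMeasure_real_univ : arcMeasure.real Set.univ = 2 * Real.pi := by
  have h := (measurePreserving_circleExp 0).measure_preimage (s := Set.univ) (by simp)
  rw [Measure.real, ← h]
  simp [Real.pi_pos.le]

/-- The chord has length 2|sin(θ/2)|, and Jordan's inequality bounds the sine from below. -/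
theorem dist_circleExp_one_ge {θ : ℝ} (h : |θ| ≤ Real.pi) :
    2 / Real.pi * |θ| ≤ dist (Circle.exp θ) 1 := by
  have h1 : dist (Circle.exp θ) 1 = 2 * |Real.sin (θ / 2)| := by
    rw [circle_dist_eq]
    simp only [Circle.coe_exp, Circle.coe_one]
    have := Complex.norm_exp_I_mul_ofReal_sub_one θ
    rw [mul_comm] at this
    rw [this, norm_mul]
    simp
  have h2 := Real.mul_abs_le_abs_sin (x := θ / 2) (by rw [abs_div]; simp; linarith)
  rw [h1]
  rw [abs_div, abs_two] at h2
  linarith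

/-- The singularity of the Cauchy kernel, weakened by a Hölder factor, is integrable. -/
theorem integrable_dist_one_rpow {s : ℝ} (hs : 0 < s) :
    Integrable (fun η : Circle => dist η 1 ^ (s - 1)) arcMeasure := by
  have hm : Measurable fun η : Circle => dist η 1 ^ (s - 1) := by
    have : Measurable fun η : Circle => dist η 1 := by fun_prop
    exact this.pow_const _
  rw [← (measurePreserving_circleExp (-Real.pi)).integrable_comp hm.aestronglyMeasurable]
  have e : -Real.pi + 2 * Real.pi = Real.pi := by ring
  rw [e]
  -- For s ≥ 1 the power is bounded. Otherwise the exponent is nonpositive, and the lower bound on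
  -- the chord dominates the function by a multiple of |θ|^(s-1).
  rcases le_total 1 s with h1 | h1
  · refine Integrable.of_bound (C := 2 ^ (s - 1))
      (hm.comp (measurePreserving_circleExp 0).measurable).aestronglyMeasurable
      (Eventually.of_forall fun θ => ?_)
    rw [Function.comp_apply, Real.norm_of_nonneg (by positivity)]
    exact Real.rpow_le_rpow dist_nonneg (circle_dist_le_two _ _) (by linarith)
  have hint : IntegrableOn (fun θ : ℝ => |θ| ^ (s - 1)) (Set.Ioc (-Real.pi) Real.pi) := by
    have h2 : IntervalIntegrable (fun θ : ℝ => |θ| ^ (s - 1)) volume 0 Real.pi := by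
      refine (intervalIntegral.intervalIntegrable_rpow' (r := s - 1) (by linarith)).congr ?_
      intro θ hθ
      rw [Set.uIoc_of_le Real.pi_pos.le] at hθ
      simp [abs_of_pos hθ.1]
    have h3 : IntervalIntegrable (fun θ : ℝ => |θ| ^ (s - 1)) volume (-Real.pi) 0 := by
      have := h2.comp_sub_left 0
      simp only [zero_sub, abs_neg, neg_zero] at this
      exact this.symm
    exact (intervalIntegrable_iff_integrableOn_Ioc_of_le (by linarith [Real.pi_pos])).1
      (h3.trans h2)
  refine (hint.const_mul ((2 / Real.pi) ^ (s - 1))).mono'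
    (hm.comp (measurePreserving_circleExp 0).measurable).aestronglyMeasurable ?_
  have hne : ∀ᵐ θ : ℝ ∂volume.restrict (Set.Ioc (-Real.pi) Real.pi), θ ≠ 0 :=
    ae_restrict_of_ae (Measure.ae_ne volume 0)
  filter_upwards [hne, ae_restrict_mem measurableSet_Ioc] with θ h0 hθ
  have hπ := Real.pi_pos
  rw [Function.comp_apply, Real.norm_of_nonneg (by positivity),
    ← Real.mul_rpow (by positivity) (by positivity)]
  exact Real.rpow_le_rpow_of_nonpos (by positivity)
    (dist_circleExp_one_ge (abs_le.2 ⟨hθ.1.le, hθ.2⟩)) (by linarith)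

theorem integral_torus_succ {n : ℕ} {f : Torus (n + 1) → ℂ} (hf : Continuous f) :
    ∫ ζ, f ζ ∂torusMeasure (n + 1) =
      ∫ η, ∫ ζ, f (Fin.cons η ζ : Fin (n + 1) → Circle) ∂torusMeasure n ∂arcMeasure := by
  have h := measurePreserving_piFinSuccAbove (fun _ : Fin (n + 1) => arcMeasure) 0
  have h' := h.symm
  rw [← integral_prod (fun p : Circle × Torus n => f (Fin.cons p.1 p.2 : Fin (n + 1) → Circle))]
  · have := h'.integral_comp' f
    rw [torusMeasure, ← this]
    refine integral_congr_ae (Eventually.of_forall fun p => ?_)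
    exact congrArg f (Fin.insertNth_zero' _ _)
  · have hc : Continuous fun p : Circle × Torus n =>
        f (Fin.cons p.1 p.2 : Fin (n + 1) → Circle) := by fun_prop
    exact hc.integrable_of_hasCompactSupport (HasCompactSupport.of_compactSpace _)

theorem integrable_torus_of_continuous {n : ℕ} {f : Torus n → ℂ} (hf : Continuous f) :
    Integrable f (torusMeasure n) :=
  hf.integrable_of_hasCompactSupport (HasCompactSupport.of_compactSpace _)

/-! ### Products of kernels with a simple singularity at `1` -/

/-- Continuous kernels on the circle, bounded by `C / |η - 1|` and of integral `c`. -/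
structure IsCauchyType (C : ℝ) (c : ℂ) (K : Circle → ℂ) : Prop where
  continuous : Continuous K
  norm_mul_dist_le : ∀ η, ‖K η‖ * dist η 1 ≤ C
  integral_eq : ∫ η, K η ∂arcMeasure = c

/-- Functions on the torus whose sup norm and Hölder seminorm of exponent `r` are at most `M`. -/
structure IsHolderBounded {D : ℕ} (M r : ℝ) (F : Torus D → ℂ) : Prop where
  norm_le : ∀ x, ‖F x‖ ≤ M
  norm_diff_le : ∀ x y, ‖F x - F y‖ ≤ M * dist x y ^ r

theorem IsHolderBounded.nonneg {D : ℕ} {M r : ℝ} {F : Torus D → ℂ} (h : IsHolderBounded M r F) :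
    0 ≤ M :=
  (norm_nonneg _).trans (h.norm_le 1)

theorem IsHolderBounded.continuous {D : ℕ} {M r : ℝ} {F : Torus D → ℂ}
    (h : IsHolderBounded M r F) (hr : 0 < r) : Continuous F := by
  rw [continuous_iff_continuousAt]
  intro x
  rw [ContinuousAt, tendsto_iff_norm_sub_tendsto_zero]
  have h1 : Tendsto (fun y => M * dist y x ^ r) (𝓝 x) (𝓝 (M * dist x x ^ r)) :=
    ((tendsto_id.dist tendsto_const_nhds).rpow_const (Or.inr hr.le)).const_mul M
  rw [dist_self, Real.zero_rpow hr.ne', mul_zero] at h1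
  exact squeeze_zero (fun _ => norm_nonneg _) (fun y => h.norm_diff_le y x) h1

theorem dist_cons_cons_left {n : ℕ} (η : Circle) (x y : Torus n) :
    dist (Fin.cons η x : Torus (n + 1)) (Fin.cons η y : Torus (n + 1)) ≤ dist x y := by
  rw [dist_pi_le_iff dist_nonneg]
  intro i
  refine Fin.cases ?_ (fun j => ?_) i
  · simp
  · simpa using dist_le_pi_dist x y j

theorem dist_cons_cons_right {n : ℕ} (η η' : Circle) (x : Torus n) :
    dist (Fin.cons η x : Torus (n + 1)) (Fin.cons η' x : Torus (n + 1)) ≤ dist η η' := by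
  rw [dist_pi_le_iff dist_nonneg]
  intro i
  refine Fin.cases ?_ (fun j => ?_) i
  · simp
  · simp

theorem IsHolderBounded.cons {n : ℕ} {M r : ℝ} {F : Torus (n + 1) → ℂ}
    (h : IsHolderBounded M r F) (hr : 0 < r) (η : Circle) :
    IsHolderBounded M r fun x : Torus n => F (Fin.cons η x) where
  norm_le _ := h.norm_le _
  norm_diff_le x y := (h.norm_diff_le _ _).trans <| mul_le_mul_of_nonneg_left
    (Real.rpow_le_rpow dist_nonneg (dist_cons_cons_left η x y) hr.le) h.nonneg

/-- Half of the Hölder exponent is traded for the decay of a difference in one variable. -/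
theorem IsHolderBounded.cons_sub_cons {n : ℕ} {M r : ℝ} {F : Torus (n + 1) → ℂ}
    (h : IsHolderBounded M r F) (hr : 0 < r) (hr1 : r ≤ 1) (η : Circle) :
    IsHolderBounded (2 * M * dist η 1 ^ (r / 2)) (r / 2)
      fun x : Torus n => F (Fin.cons η x) - F (Fin.cons 1 x) := by
  have hM := h.nonneg
  have hsplit : ∀ t : ℝ, 0 ≤ t → t ^ r = t ^ (r / 2) * t ^ (r / 2) := fun t ht => by
    rw [← Real.rpow_add_of_nonneg ht (by linarith) (by linarith), add_halves]
  have hd : ∀ x : Torus n, ‖F (Fin.cons η x) - F (Fin.cons 1 x)‖ ≤ M * dist η 1 ^ r := fun x =>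
    (h.norm_diff_le _ _).trans <| mul_le_mul_of_nonneg_left
      (Real.rpow_le_rpow dist_nonneg (dist_cons_cons_right η 1 x) hr.le) hM
  refine ⟨fun x => (hd x).trans ?_, fun x y => ?_⟩
  · have h2 : dist η 1 ^ (r / 2) ≤ 2 := by
      calc dist η 1 ^ (r / 2) ≤ 2 ^ (r / 2) :=
            Real.rpow_le_rpow dist_nonneg (circle_dist_le_two η 1) (by linarith)
        _ ≤ 2 ^ (1 : ℝ) := Real.rpow_le_rpow_of_exponent_le (by norm_num) (by linarith)
        _ = 2 := Real.rpow_one 2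
    rw [hsplit _ dist_nonneg]
    have h0 : 0 ≤ dist η 1 ^ (r / 2) := by positivity
    nlinarith [mul_le_mul_of_nonneg_left h2 (mul_nonneg hM h0)]
  · have hy : ∀ ω : Circle, ‖F (Fin.cons ω x) - F (Fin.cons ω y)‖ ≤ M * dist x y ^ r := fun ω =>
      (h.cons hr ω).norm_diff_le x y
    have h1 : ‖F (Fin.cons η x) - F (Fin.cons 1 x) - (F (Fin.cons η y) - F (Fin.cons 1 y))‖ ≤
        2 * (M * dist η 1 ^ r) :=
      (norm_sub_le _ _).trans (by linarith [hd x, hd y])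
    have h2 : ‖F (Fin.cons η x) - F (Fin.cons 1 x) - (F (Fin.cons η y) - F (Fin.cons 1 y))‖ ≤
        2 * (M * dist x y ^ r) := by
      rw [sub_sub_sub_comm]
      exact (norm_sub_le _ _).trans (by linarith [hy η, hy 1])
    -- The smaller of the two bounds is at most their geometric mean, 2M d(η,1)^{r/2} d(x,y)^{r/2}.
    rcases le_total (dist η 1) (dist x y) with hle | hle
    · refine h1.trans ?_
      rw [hsplit _ dist_nonneg]
      have := Real.rpow_le_rpow dist_nonneg hle (by linarith : 0 ≤ r / 2)
      have h0 : 0 ≤ 2 * M * dist η 1 ^ (r / 2) := by positivity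
      nlinarith [mul_le_mul_of_nonneg_left this h0]
    · refine h2.trans ?_
      rw [hsplit _ dist_nonneg]
      have := Real.rpow_le_rpow dist_nonneg hle (by linarith : 0 ≤ r / 2)
      have h0 : 0 ≤ 2 * M * dist x y ^ (r / 2) := by positivity
      nlinarith [mul_le_mul_of_nonneg_left this h0]

theorem continuous_integral_torus {n : ℕ} {X : Type*} [TopologicalSpace X]
    [FirstCountableTopology X] [LocallyCompactSpace X] {f : X → Torus n → ℂ}
    (hf : Continuous fun p : X × Torus n => f p.1 p.2) :
    Continuous fun x => ∫ ζ, f x ζ ∂torusMeasure n := by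
  simpa using continuous_parametric_integral_of_continuous (μ := torusMeasure n) hf
    (isCompact_univ (X := Torus n))

/-- The integral against a product of kernels, split by subtracting the value at `1` in the first
variable. -/
theorem integral_mul_prod_succ {n : ℕ} {F : Torus (n + 1) → ℂ} (hF : Continuous F) {C : ℝ}
    {c : Fin (n + 1) → ℂ} {K : Fin (n + 1) → Circle → ℂ} (hK : ∀ i, IsCauchyType C (c i) (K i)) :
    ∫ ζ, F ζ * ∏ i, K i (ζ i) ∂torusMeasure (n + 1) =
      c 0 * ∫ ζ : Torus n, F (Fin.cons 1 ζ) * ∏ i : Fin n, K i.succ (ζ i) ∂torusMeasure n +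
      ∫ η, K 0 η * ∫ ζ : Torus n, (F (Fin.cons η ζ) - F (Fin.cons 1 ζ)) *
        ∏ i : Fin n, K i.succ (ζ i) ∂torusMeasure n ∂arcMeasure := by
  have hKc : ∀ i, Continuous (K i) := fun i => (hK i).continuous
  have hP : Continuous fun ζ : Torus n => ∏ i : Fin n, K i.succ (ζ i) :=
    continuous_finsetProd _ fun i _ => (hKc _).comp (continuous_apply i)
  have hF1 : ∀ η : Circle, Continuous fun ζ : Torus n => F (Fin.cons η ζ) := fun η =>
    hF.comp (by fun_prop)
  have hF2 : Continuous fun p : Circle × Torus n => F (Fin.cons p.1 p.2) :=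
    hF.comp (by fun_prop)
  have hF3 : Continuous fun p : Circle × Torus n => F (Fin.cons 1 p.2) :=
    hF.comp (by fun_prop)
  -- Writing `c 0` back as the integral of `K 0` makes both sides integrals over the first circle.
  rw [integral_torus_succ (f := fun ζ => F ζ * ∏ i, K i (ζ i)) (hF.mul
    (continuous_finsetProd _ fun i _ => (hKc i).comp (continuous_apply i))),
    ← (hK 0).integral_eq, ← integral_mul_const,
    ← integral_add]
  · refine integral_congr_ae (Eventually.of_forall fun η => ?_)
    simp only [Fin.prod_univ_succ, Fin.cons_zero, Fin.cons_succ]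
    rw [← mul_add, ← integral_add, ← integral_const_mul]
    · refine integral_congr_ae (Eventually.of_forall fun ζ => ?_)
      ring
    · exact integrable_torus_of_continuous ((hF1 1).mul hP)
    · exact integrable_torus_of_continuous (((hF1 η).sub (hF1 1)).mul hP)
  · exact ((hKc 0).mul continuous_const).integrable_of_hasCompactSupport
      (HasCompactSupport.of_compactSpace _)
  · exact ((hKc 0).mul (continuous_integral_torus
      ((hF2.sub hF3).mul (hP.comp continuous_snd)))).integrable_of_hasCompactSupport
      (HasCompactSupport.of_compactSpace _)

/-- The Hölder decay of `b` at 1 weakens the simple singularity of `a` to an integrable one. At η =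
1 itself `hC` does not bound `a`, but there `hb` forces `b` to vanish. -/
theorem norm_mul_le_dist_rpow {C B M r : ℝ} {η : Circle} {a b : ℂ} (hr : 0 < r)
    (hC : ‖a‖ * dist η 1 ≤ C) (hB : 0 ≤ B) (hM : 0 ≤ M)
    (hb : ‖b‖ ≤ B * (2 * M * dist η 1 ^ r)) :
    ‖a * b‖ ≤ 2 * C * B * M * dist η 1 ^ (r - 1) := by
  have hC0 : 0 ≤ C := le_trans (by positivity) hC
  rw [norm_mul]
  rcases (dist_nonneg (x := η) (y := 1)).eq_or_lt with h | h
  · rw [← h, Real.zero_rpow hr.ne', mul_zero, mul_zero] at hb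
    rw [le_antisymm hb (norm_nonneg _), mul_zero]
    positivity
  · have h1 : dist η 1 ^ r = dist η 1 ^ (r - 1) * dist η 1 := by
      rw [← Real.rpow_add_one h.ne', sub_add_cancel]
    rw [h1] at hb
    have h0 : 0 ≤ B * (2 * M * dist η 1 ^ (r - 1)) := by positivity
    calc ‖a‖ * ‖b‖ ≤ ‖a‖ * (B * (2 * M * (dist η 1 ^ (r - 1) * dist η 1))) :=
          mul_le_mul_of_nonneg_left hb (norm_nonneg _)
      _ = (‖a‖ * dist η 1) * (B * (2 * M * dist η 1 ^ (r - 1))) := by ring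
      _ ≤ C * (B * (2 * M * dist η 1 ^ (r - 1))) := mul_le_mul_of_nonneg_right hC h0
      _ = _ := by ring

/-- `B` is chosen before the kernels and `F`; this uniformity supplies the dominating function in
the limit lemma. The induction runs over all `r`, since the difference term halves the exponent. -/
theorem exists_norm_integral_mul_prod_le (n : ℕ) (C : ℝ) (c : Fin n → ℂ) (r : ℝ) (hr : 0 < r)
    (hr1 : r ≤ 1) : ∃ B : ℝ, 0 ≤ B ∧ ∀ K : Fin n → Circle → ℂ, (∀ i, IsCauchyType C (c i) (K i)) →
      ∀ (M : ℝ) (F : Torus n → ℂ), IsHolderBounded M r F →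
        ‖∫ ζ, F ζ * ∏ i, K i (ζ i) ∂torusMeasure n‖ ≤ B * M := by
  induction n generalizing r with
  | zero =>
    refine ⟨(torusMeasure 0).real Set.univ, measureReal_nonneg, fun K _ M F hF => ?_⟩
    rw [mul_comm]
    refine norm_integral_le_of_norm_le_const (Eventually.of_forall fun ζ => ?_)
    simpa using hF.norm_le ζ
  | succ n ih =>
    obtain ⟨B₁, hB₁, h₁⟩ := ih (fun i => c i.succ) r hr hr1
    obtain ⟨B₂, hB₂, h₂⟩ := ih (fun i => c i.succ) (r / 2) (by linarith) (by linarith)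
    set J := ∫ η : Circle, dist η 1 ^ (r / 2 - 1) ∂arcMeasure
    have hJ : 0 ≤ J := integral_nonneg fun η => Real.rpow_nonneg dist_nonneg _
    -- The absolute value keeps the constant nonnegative at a stage where no kernel is available to
    -- force `C ≥ 0`.
    refine ⟨‖c 0‖ * B₁ + 2 * |C| * B₂ * J, by positivity, fun K hK M F hF => ?_⟩
    have hC : |C| = C := abs_of_nonneg (le_trans (by positivity) ((hK 0).norm_mul_dist_le 1))
    rw [integral_mul_prod_succ (hF.continuous hr) hK, hC, add_mul]
    refine (norm_add_le _ _).trans (add_le_add ?_ ?_)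
    · rw [norm_mul, mul_assoc]
      exact mul_le_mul_of_nonneg_left (h₁ _ (fun i => hK i.succ) M _ (hF.cons hr 1))
        (norm_nonneg _)
    · have hb := norm_integral_le_of_norm_le
        ((integrable_dist_one_rpow (half_pos hr)).const_mul (2 * C * B₂ * M))
        (Eventually.of_forall fun η => norm_mul_le_dist_rpow (half_pos hr)
          ((hK 0).norm_mul_dist_le η) hB₂ hF.nonneg
          (h₂ _ (fun i => hK i.succ) _ _ (hF.cons_sub_cons hr hr1 η)))
      refine hb.trans (le_of_eq ?_)
      rw [integral_const_mul]
      ring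

/-- Limits of integrals of a Hölder function against products of kernels of Cauchy type. -/
theorem exists_tendsto_integral_mul_prod {T : Type*} {l : Filter T} [l.IsCountablyGenerated]
    (n : ℕ) (C : ℝ) (c : Fin n → ℂ) (K : Fin n → T → Circle → ℂ) (k : Fin n → Circle → ℂ)
    (hK : ∀ᶠ t in l, ∀ i, IsCauchyType C (c i) (K i t))
    (hk : ∀ i, ∀ η ≠ 1, Tendsto (fun t => K i t η) l (𝓝 (k i η)))
    (r : ℝ) (hr : 0 < r) (hr1 : r ≤ 1) (M : ℝ) (F : T → Torus n → ℂ) (F₀ : Torus n → ℂ)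
    (hF : ∀ᶠ t in l, IsHolderBounded M r (F t))
    (hF₀ : ∀ ζ, Tendsto (fun t => F t ζ) l (𝓝 (F₀ ζ))) :
    ∃ L : ℂ, Tendsto (fun t => ∫ ζ, F t ζ * ∏ i, K i t (ζ i) ∂torusMeasure n) l (𝓝 L) ∧
      ((∀ i, ∀ η ≠ 1, k i η = 0) → L = (∏ i, c i) * F₀ 1) := by
  classical
  induction n generalizing r M with
  | zero =>
    refine ⟨F₀ 1, (hF₀ 1).congr fun t => ?_, fun _ => by simp⟩
    have : torusMeasure 0 = Measure.dirac 1 := Measure.pi_of_empty _ 1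
    simp [this]
  | succ n ih =>
    have hK' : ∀ᶠ t in l, ∀ i : Fin n, IsCauchyType C (c i.succ) (K i.succ t) :=
      hK.mono fun t h i => h i.succ
    obtain ⟨L₁, hL₁, hz₁⟩ := ih (fun i => c i.succ) (fun i => K i.succ) (fun i => k i.succ) hK'
      (fun i => hk i.succ) r hr hr1 M (fun t ζ => F t (Fin.cons 1 ζ))
      (fun ζ => F₀ (Fin.cons 1 ζ)) (hF.mono fun t h => h.cons hr 1) fun ζ => hF₀ _
    have hG : ∀ η : Circle, ∃ L : ℂ, Tendsto (fun t => ∫ ζ : Torus n,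
        (F t (Fin.cons η ζ) - F t (Fin.cons 1 ζ)) * ∏ i : Fin n, K i.succ t (ζ i)
          ∂torusMeasure n) l (𝓝 L) := fun η =>
      (ih (fun i => c i.succ) (fun i => K i.succ) (fun i => k i.succ) hK'
        (fun i => hk i.succ) (r / 2) (by linarith) (by linarith) _
        (fun t ζ => F t (Fin.cons η ζ) - F t (Fin.cons 1 ζ))
        (fun ζ => F₀ (Fin.cons η ζ) - F₀ (Fin.cons 1 ζ))
        (hF.mono fun t h => h.cons_sub_cons hr hr1 η) fun ζ => (hF₀ _).sub (hF₀ _)).imp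
          fun L h => h.1
    choose G hG using hG
    obtain ⟨B, hB, hbound⟩ := exists_norm_integral_mul_prod_le n C (fun i => c i.succ) (r / 2)
      (by linarith) (by linarith)
    have hlim : Tendsto (fun t => ∫ η, K 0 t η * ∫ ζ : Torus n,
        (F t (Fin.cons η ζ) - F t (Fin.cons 1 ζ)) * ∏ i : Fin n, K i.succ t (ζ i)
          ∂torusMeasure n ∂arcMeasure) l
        -- At η = 1 the kernel need not converge, but the inner difference is identically zero
        -- there.
        (𝓝 (∫ η, if η = 1 then 0 else k 0 η * G η ∂arcMeasure)) := by
      refine tendsto_integral_filter_of_dominated_convergence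
        (fun η => 2 * C * B * M * dist η 1 ^ (r / 2 - 1)) ?_ ?_
        ((integrable_dist_one_rpow (half_pos hr)).const_mul _)
        (Eventually.of_forall fun η => ?_)
      · filter_upwards [hK, hF] with t hKt hFt
        have hFc := hFt.continuous hr
        have hP : Continuous fun p : Circle × Torus n => ∏ i : Fin n, K i.succ t (p.2 i) :=
          continuous_finsetProd _ fun i _ => (hKt _).continuous.comp (by fun_prop)
        have h1 : Continuous fun p : Circle × Torus n => F t (Fin.cons p.1 p.2) :=
          hFc.comp (by fun_prop)
        have h2 : Continuous fun p : Circle × Torus n => F t (Fin.cons 1 p.2) :=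
          hFc.comp (by fun_prop)
        exact ((hKt 0).continuous.mul
          (continuous_integral_torus ((h1.sub h2).mul hP))).aestronglyMeasurable
      · filter_upwards [hK, hF] with t hKt hFt
        exact Eventually.of_forall fun η => norm_mul_le_dist_rpow (half_pos hr)
          ((hKt 0).norm_mul_dist_le η) hB hFt.nonneg
          (hbound _ (fun i => hKt i.succ) _ _ (hFt.cons_sub_cons hr hr1 η))
      · by_cases hη : η = 1
        · simpa [hη] using tendsto_const_nhds
        · rw [if_neg hη]
          exact (hk 0 η hη).mul (hG η)
    refine ⟨_, ((hL₁.const_mul (c 0)).add hlim).congr' ?_, fun hzero => ?_⟩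
    · filter_upwards [hK, hF] with t hKt hFt
      exact (integral_mul_prod_succ (hFt.continuous hr) hKt).symm
    · have h1 : (Fin.cons 1 (1 : Torus n) : Torus (n + 1)) = 1 := by
        funext i
        refine Fin.cases ?_ (fun j => ?_) i <;> simp
      have h2 : ∀ η : Circle, (if η = 1 then 0 else k 0 η * G η) = 0 := fun η => by
        split_ifs with h
        · rfl
        · rw [hzero 0 η h, zero_mul]
      rw [hz₁ fun i => hzero i.succ, h1, Fin.prod_univ_succ]
      simp only [h2, integral_zero]
      ring

/-! ### The Cauchy-Mohammed kernel as a product of geometric kernels -/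

/-- The sum `v ^ e + v ^ (e + 1) + ⋯` of a geometric series. -/
def geomKernel (e : ℕ) (v : ℂ) : ℂ := v ^ e / (1 - v)

theorem geomKernel_continuousAt (e : ℕ) {v : ℂ} (hv : v ≠ 1) : ContinuousAt (geomKernel e) v :=
  (by fun_prop : ContinuousAt (fun v : ℂ => v ^ e) v).div (by fun_prop)
    (sub_ne_zero.2 hv.symm)

theorem hasSum_geomKernel {v : ℂ} (hv : ‖v‖ < 1) (e : ℕ) :
    HasSum (fun n : ℕ => v ^ (n + e)) (geomKernel e v) := by
  have := (hasSum_geometric_of_norm_lt_one hv).mul_right (v ^ e)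
  simp only [← pow_add] at this
  rwa [mul_comm, ← div_eq_mul_inv] at this

theorem hasSum_mul_of_summable_norm {ι κ : Type*} {f : ι → ℂ} {g : κ → ℂ}
    (hf : Summable fun a => ‖f a‖) (hg : Summable fun b => ‖g b‖) :
    HasSum (fun p : ι × κ => f p.1 * g p.2) ((∑' a, f a) * ∑' b, g b) :=
  hf.of_norm.hasSum.mul hg.of_norm.hasSum (summable_mul_of_summable_norm hf hg)

/-- Multiplies absolutely convergent series one variable at a time. Norm summability is carried
along because the next multiplication needs it. -/
theorem hasSum_prod_apply {ι : Type*} (n : ℕ) (h : Fin n → ι → ℂ)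
    (hs : ∀ i, Summable fun a => ‖h i a‖) :
    (Summable fun α : Fin n → ι => ‖∏ i, h i (α i)‖) ∧
      HasSum (fun α : Fin n → ι => ∏ i, h i (α i)) (∏ i, ∑' a, h i a) := by
  induction n with
  | zero =>
    have : Unique (Fin 0 → ι) := Pi.uniqueOfIsEmpty _
    exact ⟨(hasSum_unique _).summable, by simp⟩
  | succ n ih =>
    obtain ⟨h1, h2⟩ := ih (fun i => h i.succ) fun i => hs i.succ
    obtain ⟨E, hE⟩ : ∃ E : ι × (Fin n → ι) ≃ (Fin (n + 1) → ι), ∀ p, E p = Fin.cons p.1 p.2 :=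
      ⟨Fin.consEquiv fun _ => ι, fun _ => rfl⟩
    have e : ∀ p, ∏ i, h i (E p i) = h 0 p.1 * ∏ i : Fin n, h i.succ (p.2 i) := fun p => by
      simp [Fin.prod_univ_succ, hE]
    constructor
    · rw [← E.summable_iff]
      simpa only [Function.comp_def, e, norm_mul] using
        (hs 0).mul_of_nonneg h1 (fun _ => norm_nonneg _) (fun _ => norm_nonneg _)
    · rw [← E.hasSum_iff, Fin.prod_univ_succ, ← h2.tsum_eq]
      simp only [Function.comp_def, e]
      have h3 := hasSum_mul_of_summable_norm (hs 0) h1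
      exact h3

section Monomials

variable {D : ℕ}

theorem norm_toC (ξ : Torus D) (i : Fin D) : ‖toC ξ i‖ = 1 := Circle.norm_coe (ξ i)

theorem toC_ne_zero (ξ : Torus D) (i : Fin D) : toC ξ i ≠ 0 := Circle.coe_ne_zero (ξ i)

theorem conj_toC (ξ : Torus D) (i : Fin D) : conj (toC ξ i) = (toC ξ i)⁻¹ := by
  rw [toC, ← Circle.coe_inv_eq_conj, Circle.coe_inv]

theorem continuous_toC_apply (i : Fin D) : Continuous fun ξ : Torus D => toC ξ i :=
  continuous_subtype_val.comp (continuous_apply i)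

theorem conj_mono_mul_mono (z : Fin D → ℂ) (ξ : Torus D) (α : Fin D → ℤ) :
    conj (mono (toC ξ) α) * mono z α = ∏ i, (z i / toC ξ i) ^ α i := by
  simp only [mono, map_prod, ← Finset.prod_mul_distrib]
  refine Finset.prod_congr rfl fun i _ => ?_
  rw [map_zpow₀, conj_toC, ← mul_zpow, mul_comm, ← div_eq_mul_inv]

theorem continuous_mono_toC (α : Fin D → ℤ) : Continuous fun ξ : Torus D => mono (toC ξ) α :=
  continuous_finsetProd _ fun i _ =>
    (continuous_toC_apply i).zpow₀ _ fun ξ => Or.inl (toC_ne_zero ξ i)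

theorem norm_mono_toC (α : Fin D → ℤ) (ξ : Torus D) : ‖mono (toC ξ) α‖ = 1 := by
  simp [mono, norm_toC]

theorem conj_mono_toC (α : Fin D → ℤ) (ξ : Torus D) :
    conj (mono (toC ξ) α) = mono (toC ξ) (-α) := by
  simp only [mono, map_prod, map_zpow₀, conj_toC, Pi.neg_apply, inv_zpow, zpow_neg]

/-- The ratio of the geometric series in the `i`-th variable. -/
def orthantRatio (σ : Finset (Fin D)) (i : Fin D) (u : ℂ) : ℂ := if i ∈ σ then u⁻¹ else u

theorem norm_orthantRatio_lt_one {σ : Finset (Fin D)} {z : Fin D → ℂ} (hz : z ∈ polydisk σ)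
    (ξ : Torus D) (i : Fin D) : ‖orthantRatio σ i (z i / toC ξ i)‖ < 1 := by
  have := hz i
  unfold orthantRatio
  split_ifs at this ⊢
  · rw [norm_inv, norm_div, norm_toC, div_one]
    exact inv_lt_one_of_one_lt₀ this
  · rwa [norm_div, norm_toC, div_one]

end Monomials

/-! ### Orthants as boxes, and the closed form of the kernel -/

section Orthant

variable {D : ℕ} [NeZero D]

/-- The least absolute value of the `i`-th coordinate in the orthant of `σ`. -/
def orthantShift (σ : Finset (Fin D)) (i : Fin D) : ℕ :=
  if i ∈ σ ↔ i + 1 ∈ σ then 0 else 1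

/-- The set of values of the `i`-th coordinate in the orthant of `σ`. -/
def orthantSide (σ : Finset (Fin D)) (i : Fin D) : Set ℤ :=
  {n | if i ∈ σ then n ≤ -orthantShift σ i else orthantShift σ i ≤ n}

/-- An inequality is strict exactly where membership in σ changes from i to i + 1, so every orthant
is a box of half-lines. Only for the full σ must the origin be removed from the box. -/
theorem mem_orthant_iff {σ : Finset (Fin D)} {α : Fin D → ℤ} :
    α ∈ orthant σ ↔ (∀ i, α i ∈ orthantSide σ i) ∧ (σ = Finset.univ → α ≠ 0) := by
  unfold orthant
  split_ifs with h
  · subst h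
    simp [orthantSide, orthantShift]
  · simp only [Set.mem_ofPred_eq, h, false_imp_iff, and_true, rightBoundary, orthantSide,
      orthantShift, Finset.mem_sdiff, Finset.mem_filter, Finset.mem_compl]
    constructor
    · rintro ⟨h1, h2, h3, h4⟩ i
      have h1 := h1 i
      have h2 := h2 i
      have h3 := h3 i
      have h4 := h4 i
      by_cases hi : i ∈ σ <;> by_cases hj : i + 1 ∈ σ <;> simp [hi, hj] at * <;> omega
    · intro H
      refine ⟨fun i hi => ?_, fun i hi => ?_, fun i hi => ?_, fun i hi => ?_⟩ <;>
      · have H := H i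
        by_cases hi : i ∈ σ <;> by_cases hj : i + 1 ∈ σ <;> simp [hi, hj] at * <;> omega

theorem hasSum_orthantSide (σ : Finset (Fin D)) (i : Fin D) {u : ℂ}
    (hu : ‖orthantRatio σ i u‖ < 1) :
    (Summable fun n : ℤ => ‖(orthantSide σ i).indicator (fun n => u ^ n) n‖) ∧
      HasSum (fun n : ℤ => (orthantSide σ i).indicator (fun n => u ^ n) n)
        (geomKernel (orthantShift σ i) (orthantRatio σ i u)) := by
  set e := orthantShift σ i
  -- Enumerates the half-line outwards from its end point, turning the two-sided sum into a
  -- geometric series.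
  set φ : ℕ → ℤ := fun n => if i ∈ σ then -((n + e : ℕ) : ℤ) else ((n + e : ℕ) : ℤ) with hφ
  have hinj : Function.Injective φ := by
    intro a b hab
    simp only [hφ] at hab
    split_ifs at hab <;> omega
  have hsupp : ∀ n ∉ Set.range φ, (orthantSide σ i).indicator (fun n => u ^ n) n = 0 := by
    intro n hn
    refine Set.indicator_of_notMem (fun hmem => hn ?_) _
    simp only [orthantSide, Set.mem_ofPred_eq] at hmem
    split_ifs at hmem with hi
    · exact ⟨(-n - e).toNat, by simp only [hφ, if_pos hi]; omega⟩
    · exact ⟨(n - e).toNat, by simp only [hφ, if_neg hi]; omega⟩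
  have hval : ∀ n, (orthantSide σ i).indicator (fun n => u ^ n) (φ n) =
      orthantRatio σ i u ^ (n + e) := by
    intro n
    have hm : φ n ∈ orthantSide σ i := by
      simp only [orthantSide, Set.mem_ofPred_eq, hφ]
      split_ifs <;> omega
    rw [Set.indicator_of_mem hm]
    simp only [hφ, orthantRatio]
    split_ifs
    · rw [zpow_neg, zpow_natCast, inv_pow]
    · rw [zpow_natCast]
  constructor
  · rw [← hinj.summable_iff fun n hn => by rw [hsupp n hn, norm_zero]]
    simp only [Function.comp_def, hval, pow_add, norm_mul, norm_pow]
    exact (summable_geometric_of_lt_one (norm_nonneg _) hu).mul_right _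
  · rw [← hinj.hasSum_iff hsupp]
    simp only [Function.comp_def, hval]
    exact hasSum_geomKernel hu _

theorem indicator_orthant_prod (σ : Finset (Fin D)) (u : Fin D → ℂ) (α : Fin D → ℤ) :
    (orthant σ).indicator (fun α => ∏ i, u i ^ α i) α =
      (∏ i, (orthantSide σ i).indicator (fun n => u i ^ n) (α i)) -
        if σ = Finset.univ then Pi.single (M := fun _ => ℂ) (0 : Fin D → ℤ) 1 α else 0 := by
  classical
  by_cases hbox : ∀ i, α i ∈ orthantSide σ i
  · have h1 : (∏ i, (orthantSide σ i).indicator (fun n => u i ^ n) (α i)) = ∏ i, u i ^ α i :=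
      Finset.prod_congr rfl fun i _ => Set.indicator_of_mem (hbox i) _
    rw [h1]
    by_cases hσ : σ = Finset.univ
    · by_cases hα : α = 0
      · subst hα
        rw [Set.indicator_of_notMem fun h => (mem_orthant_iff.1 h).2 hσ rfl]
        simp [hσ]
      · rw [Set.indicator_of_mem (mem_orthant_iff.2 ⟨hbox, fun _ => hα⟩)]
        simp [hα]
    · rw [Set.indicator_of_mem (mem_orthant_iff.2 ⟨hbox, fun h => absurd h hσ⟩)]
      simp [hσ]
  · rw [Set.indicator_of_notMem fun h => hbox (mem_orthant_iff.1 h).1]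
    push Not at hbox
    obtain ⟨i, hi⟩ := hbox
    rw [Finset.prod_eq_zero (Finset.mem_univ i) (Set.indicator_of_notMem hi _)]
    split_ifs with hσ
    · have : α ≠ 0 := by
        rintro rfl
        apply hi
        simp [orthantSide, orthantShift, hσ]
      simp [this]
    · simp

theorem conj_mono_mul_chiOrthant (σ : Finset (Fin D)) (z : Fin D → ℂ) (ξ : Torus D)
    (α : Fin D → ℤ) : conj (mono (toC ξ) α) * chiOrthant σ z α =
      (orthant σ).indicator (fun α => ∏ i, (z i / toC ξ i) ^ α i) α := by
  unfold chiOrthant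
  by_cases h : α ∈ orthant σ
  · rw [Set.indicator_of_mem h, Set.indicator_of_mem h, conj_mono_mul_mono]
  · rw [Set.indicator_of_notMem h, Set.indicator_of_notMem h, mul_zero]

/-- Over a box the series factors into geometric series. The subtracted 1 is the term α = 0, absent
from the orthant of the full σ. -/
theorem hasSum_cauchyKernel {σ : Finset (Fin D)} {z : Fin D → ℂ} (hz : z ∈ polydisk σ)
    (ξ : Torus D) :
    (Summable fun α => ‖conj (mono (toC ξ) α) * chiOrthant σ z α‖) ∧
      HasSum (fun α => conj (mono (toC ξ) α) * chiOrthant σ z α)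
        ((∏ i, geomKernel (orthantShift σ i) (orthantRatio σ i (z i / toC ξ i))) -
          if σ = Finset.univ then 1 else 0) := by
  classical
  have h1 := fun i => hasSum_orthantSide σ i (norm_orthantRatio_lt_one hz ξ i)
  obtain ⟨h2, h3⟩ := hasSum_prod_apply D _ fun i => (h1 i).1
  simp only [fun i => (h1 i).2.tsum_eq] at h3
  have h4 : HasSum (fun α : Fin D → ℤ => if σ = Finset.univ then
      Pi.single (M := fun _ => ℂ) (0 : Fin D → ℤ) 1 α else 0)
      (if σ = Finset.univ then 1 else 0) := by
    split_ifs
    · exact hasSum_pi_single 0 1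
    · exact hasSum_zero
  have h5 := h3.sub h4
  simp only [← indicator_orthant_prod, ← conj_mono_mul_chiOrthant] at h5
  exact ⟨h5.summable.norm, h5⟩

theorem cauchyKernel_eq {σ : Finset (Fin D)} {z : Fin D → ℂ} (hz : z ∈ polydisk σ)
    (ξ : Torus D) : cauchyKernel σ z ξ =
      (∏ i, geomKernel (orthantShift σ i) (orthantRatio σ i (z i / toC ξ i))) -
        if σ = Finset.univ then 1 else 0 :=
  (hasSum_cauchyKernel hz ξ).2.tsum_eq

theorem continuous_cauchyKernel {σ : Finset (Fin D)} {z : Fin D → ℂ} (hz : z ∈ polydisk σ) :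
    Continuous (cauchyKernel σ z) := by
  rw [show cauchyKernel σ z = _ from funext fun ξ => cauchyKernel_eq hz ξ]
  refine (continuous_finsetProd _ fun i _ => continuous_iff_continuousAt.2 fun ξ => ?_).sub
    continuous_const
  refine ContinuousAt.comp (g := geomKernel _)
    (f := fun ξ : Torus D => orthantRatio σ i (z i / toC ξ i)) (geomKernel_continuousAt _ ?_) ?_
  · intro h
    have := norm_orthantRatio_lt_one hz ξ i
    rw [h, norm_one] at this
    exact lt_irrefl _ this
  · have hc := continuous_toC_apply i
    unfold orthantRatio
    split_ifs
    · simp only [inv_div]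
      exact (hc.div_const _).continuousAt
    · exact (continuous_const.div hc fun ξ => toC_ne_zero ξ i).continuousAt

/-- The holomorphic orthant extension is a Cauchy integral. -/
theorem orthantExtension_eq {f : Torus D → ℂ} (hf : Continuous f) {σ : Finset (Fin D)}
    {z : Fin D → ℂ} (hz : z ∈ polydisk σ) :
    orthantExtension f σ z =
      ((2 * Real.pi : ℂ) ^ D)⁻¹ * oint fun ξ => f ξ * cauchyKernel σ z ξ := by
  have hc : ∀ α : Fin D → ℤ,
      Continuous fun ξ : Torus D => f ξ * (conj (mono (toC ξ) α) * chiOrthant σ z α) := fun α =>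
    hf.mul ((Complex.continuous_conj.comp (continuous_mono_toC α)).mul continuous_const)
  obtain ⟨M, hM⟩ := (isCompact_univ (X := Torus D)).exists_bound_of_continuousOn hf.continuousOn
  have hsum : Summable fun α : Fin D → ℤ =>
      ∫ ξ : Torus D, ‖f ξ * (conj (mono (toC ξ) α) * chiOrthant σ z α)‖ ∂torusMeasure D := by
    -- Monomials have modulus 1 on the torus, so summability at ξ = 1 dominates every ξ.
    have h1 := (hasSum_cauchyKernel hz 1).1
    refine Summable.of_nonneg_of_le (fun α => integral_nonneg fun _ => norm_nonneg _) (fun α => ?_)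
      ((h1.mul_left M).mul_left ((torusMeasure D).real Set.univ))
    calc _ ≤ ∫ ξ : Torus D, M * ‖conj (mono (toC (1 : Torus D)) α) * chiOrthant σ z α‖
          ∂torusMeasure D := by
          refine integral_mono (integrable_torus_of_continuous (hc α)).norm
            (integrable_const _) fun ξ => ?_
          simp only [norm_mul, RCLike.norm_conj, norm_mono_toC]
          exact mul_le_mul_of_nonneg_right (hM ξ trivial) (by positivity)
      _ = _ := by simp
  have h := hasSum_integral_of_summable_integral_norm
    (fun α => integrable_torus_of_continuous (hc α)) hsum
  rw [oint_eq_integral (f := fun ξ => f ξ * cauchyKernel σ z ξ)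
    (hf.mul (continuous_cauchyKernel hz)).aestronglyMeasurable]
  simp only [cauchyKernel, ← tsum_mul_left]
  rw [← h.tsum_eq, ← tsum_mul_left]
  refine tsum_congr fun α => ?_
  rw [fourierCoefficient, oint_eq_integral (f := fun ζ => f ζ * mono (toC ζ) (-α))
    (hf.mul (continuous_mono_toC _)).aestronglyMeasurable, mul_assoc, ← integral_mul_const]
  simp only [conj_mono_toC, mul_assoc]

end Orthant

/-! ### Boundary limits of Cauchy-Mohammed integrals -/

theorem continuous_circle_zpow (m : ℤ) : Continuous fun η : Circle => (η : ℂ) ^ m :=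
  continuous_subtype_val.zpow₀ _ fun η => Or.inl (Circle.coe_ne_zero η)

/-- Rotation by π/m changes the sign of η^m, so by invariance the integral equals its negative. -/
theorem integral_circle_zpow {m : ℤ} (hm : m ≠ 0) :
    ∫ η : Circle, (η : ℂ) ^ m ∂arcMeasure = 0 := by
  have h := integral_mul_left_eq_self (μ := arcMeasure) (fun η : Circle => (η : ℂ) ^ m)
    (Circle.exp (Real.pi / m))
  have h1 : (Circle.exp (Real.pi / m) : ℂ) ^ m = -1 := by
    have hm' : (m : ℂ) ≠ 0 := Int.cast_ne_zero.2 hm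
    rw [Circle.coe_exp, ← Complex.exp_int_mul, ← Complex.exp_pi_mul_I]
    congr 1
    push_cast
    field_simp
  simp only [Circle.coe_mul, mul_zpow, h1, integral_const_mul] at h
  have h2 : (2 : ℂ) * ∫ η : Circle, (η : ℂ) ^ m ∂arcMeasure = 0 := by linear_combination -h
  simpa using h2

/-- Only the constant term of the series has a nonzero integral, and it occurs only for `e = 0`. The
value does not depend on ρ. -/
theorem integral_circle_geomKernel (e : ℕ) {ρ : ℝ} (h0 : 0 ≤ ρ) (h1 : ρ < 1) {ε : ℤ}
    (hε : ε ≠ 0) : ∫ η : Circle, geomKernel e (ρ * (η : ℂ) ^ ε) ∂arcMeasure =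
      if e = 0 then (2 * Real.pi : ℂ) else 0 := by
  have hn : ∀ η : Circle, ‖(ρ : ℂ) * (η : ℂ) ^ ε‖ = ρ := fun η => by
    rw [norm_mul, norm_zpow, Circle.norm_coe, one_zpow, mul_one, Complex.norm_of_nonneg h0]
  have hc : ∀ n : ℕ, Continuous fun η : Circle => ((ρ : ℂ) * (η : ℂ) ^ ε) ^ (n + e) := fun n =>
    (continuous_const.mul (continuous_circle_zpow ε)).pow _
  have hs := hasSum_integral_of_summable_integral_norm (μ := arcMeasure)
    (fun n => (hc n).integrable_of_hasCompactSupport (HasCompactSupport.of_compactSpace _)) (by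
      have h2 : ∀ n : ℕ, ∫ η : Circle, ‖((ρ : ℂ) * (η : ℂ) ^ ε) ^ (n + e)‖ ∂arcMeasure =
          arcMeasure.real Set.univ * (ρ ^ n * ρ ^ e) := fun n => by
        calc _ = ∫ _ : Circle, ρ ^ n * ρ ^ e ∂arcMeasure :=
              integral_congr_ae (Eventually.of_forall fun η => by
                rw [norm_pow, hn, pow_add])
          _ = _ := by rw [integral_const, smul_eq_mul]
      rw [funext h2]
      exact ((summable_geometric_of_lt_one h0 h1).mul_right _).mul_left _)
  have hval : ∀ n : ℕ, ∫ η : Circle, ((ρ : ℂ) * (η : ℂ) ^ ε) ^ (n + e) ∂arcMeasure =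
      if n + e = 0 then (2 * Real.pi : ℂ) else 0 := by
    intro n
    split_ifs with h
    · simp [h, arcMeasure_real_univ]
    · calc _ = ∫ η : Circle, (ρ : ℂ) ^ (n + e) * (η : ℂ) ^ (ε * (n + e : ℕ)) ∂arcMeasure :=
            integral_congr_ae (Eventually.of_forall fun η => by
              rw [mul_pow, ← zpow_natCast, ← zpow_natCast]
              exact congrArg _ (zpow_mul (η : ℂ) ε _).symm)
        _ = 0 := by
          rw [integral_const_mul, integral_circle_zpow (mul_ne_zero hε (Nat.cast_ne_zero.2 h)),
            mul_zero]
  have hsum : ∀ η : Circle, ∑' n : ℕ, ((ρ : ℂ) * (η : ℂ) ^ ε) ^ (n + e) =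
      geomKernel e (ρ * (η : ℂ) ^ ε) := fun η =>
    (hasSum_geomKernel (by rwa [hn]) e).tsum_eq
  simp only [hval, hsum] at hs
  refine hs.unique ?_
  split_ifs with he
  · subst he
    simpa using hasSum_ite_eq (0 : ℕ) (2 * Real.pi : ℂ)
  · simp [he]

/-- The uniform constant 2 comes from |1 - w| ≤ |1 - ρw| + (1 - ρ) and 1 - ρ ≤ |1 - ρw| for |w| = 1.
-/
theorem isCauchyType_geomKernel (e : ℕ) {ρ : ℝ} (h0 : 0 ≤ ρ) (h1 : ρ < 1) {ε : ℤ}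
    (hε : ε = 1 ∨ ε = -1) :
    IsCauchyType 2 (if e = 0 then 2 * Real.pi else 0)
      fun η : Circle => geomKernel e (ρ * (η : ℂ) ^ ε) := by
  have hn : ∀ η : Circle, ‖(ρ : ℂ) * (η : ℂ) ^ ε‖ = ρ := fun η => by
    rw [norm_mul, norm_zpow, Circle.norm_coe, one_zpow, mul_one, Complex.norm_of_nonneg h0]
  have hε0 : ε ≠ 0 := by omega
  refine ⟨?_, fun η => ?_, integral_circle_geomKernel e h0 h1 hε0⟩
  · refine continuous_iff_continuousAt.2 fun η => ?_
    refine ContinuousAt.comp (g := geomKernel e) (f := fun η : Circle => (ρ : ℂ) * (η : ℂ) ^ ε)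
      (geomKernel_continuousAt e fun h => ?_)
      (continuous_const.mul (continuous_circle_zpow ε)).continuousAt
    have := hn η
    rw [h, norm_one] at this
    linarith
  · have hd : dist η 1 = ‖1 - (η : ℂ) ^ ε‖ := by
      rw [circle_dist_eq, Circle.coe_one]
      rcases hε with h | h
      · rw [h, zpow_one, norm_sub_rev]
      · have : (1 : ℂ) - (η : ℂ) ^ (-1 : ℤ) = (η : ℂ)⁻¹ * (η - 1) := by
          rw [zpow_neg_one, mul_sub, inv_mul_cancel₀ (Circle.coe_ne_zero η), mul_one]
        rw [h, this, norm_mul, norm_inv, Circle.norm_coe, inv_one, one_mul]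
    set w := (η : ℂ) ^ ε
    have hw : ‖w‖ = 1 := by
      simp only [w]
      rw [norm_zpow, Circle.norm_coe, one_zpow]
    have hlow : 1 - ρ ≤ ‖1 - ρ * w‖ := by
      have := norm_sub_norm_le (1 : ℂ) (ρ * w)
      rwa [norm_one, hn] at this
    have hle : ‖1 - w‖ ≤ 2 * ‖1 - ρ * w‖ := by
      have e1 : 1 - w = (1 - ρ * w) - ((1 - ρ : ℝ) : ℂ) * w := by
        push_cast
        ring
      calc ‖1 - w‖ ≤ ‖1 - ρ * w‖ + ‖((1 - ρ : ℝ) : ℂ) * w‖ := e1 ▸ norm_sub_le _ _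
        _ = ‖1 - ρ * w‖ + (1 - ρ) := by
          rw [norm_mul, hw, mul_one, Complex.norm_of_nonneg (by linarith)]
        _ ≤ _ := by linarith
    have hpos : 0 < ‖1 - ρ * w‖ := by linarith
    rw [hd, geomKernel, norm_div, norm_pow, hn, div_mul_eq_mul_div, div_le_iff₀ hpos]
    calc ρ ^ e * ‖1 - w‖ ≤ 1 * ‖1 - w‖ :=
          mul_le_mul_of_nonneg_right (pow_le_one₀ h0 h1.le) (norm_nonneg _)
      _ ≤ _ := by linarith

/-- The point of the torus with the same arguments. -/
def unitPart {D : ℕ} (z : Fin D → ℂ) : Torus D := fun i => Circle.exp (z i).arg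

theorem norm_mul_unitPart {D : ℕ} (z : Fin D → ℂ) (i : Fin D) :
    (‖z i‖ : ℂ) * toC (unitPart z) i = z i :=
  Complex.norm_mul_exp_arg_mul_I (z i)

/-- The argument jumps across the negative axis, so continuity is read off from z/|z| instead. -/
theorem tendsto_unitPart {D : ℕ} (ζ : Torus D) :
    Tendsto unitPart (𝓝 (toC ζ)) (𝓝 ζ) := by
  refine tendsto_pi_nhds.2 fun i => tendsto_subtype_rng.2 ?_
  have h1 : Tendsto (fun z : Fin D → ℂ => z i) (𝓝 (toC ζ)) (𝓝 (toC ζ i)) :=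
    (continuous_apply i).continuousAt
  have h2 : Tendsto (fun z : Fin D → ℂ => z i / (‖z i‖ : ℂ)) (𝓝 (toC ζ))
      (𝓝 (toC ζ i / (‖toC ζ i‖ : ℂ))) :=
    h1.div ((Complex.continuous_ofReal.tendsto _).comp h1.norm) (by simp [norm_toC])
  rw [norm_toC, Complex.ofReal_one, div_one] at h2
  refine h2.congr' ?_
  filter_upwards [h1.eventually_ne (toC_ne_zero ζ i)] with z hz
  rw [div_eq_iff (by simpa using hz), mul_comm]
  exact (norm_mul_unitPart z i).symm

theorem IsHolderBounded.comp_mul_left {D : ℕ} {M r : ℝ} {f : Torus D → ℂ}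
    (hf : IsHolderBounded M r f) (a : Torus D) : IsHolderBounded M r fun η => f (a * η) := by
  refine ⟨fun η => hf.norm_le _, fun x y => (hf.norm_diff_le _ _).trans (le_of_eq ?_)⟩
  congr 2
  simp only [dist_pi_def, Pi.mul_apply]
  congr 2
  funext i
  refine NNReal.eq ?_
  simp only [coe_nndist, circle_dist_eq, Circle.coe_mul]
  rw [← mul_sub, norm_mul, Circle.norm_coe, one_mul]

/-- Substituting ξ = `unitPart z` · η fixes the singularity at η = 1 and moves the arguments of z
into `f`, whose Hölder bounds are rotation invariant. This is why no restriction on the approach to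
ζ is needed. -/
theorem exists_tendsto_cauchyIntegral {D : ℕ} [NeZero D] {M r : ℝ} (hr : 0 < r) (hr1 : r ≤ 1)
    {f : Torus D → ℂ} (hf : IsHolderBounded M r f) (σ : Finset (Fin D)) (ζ : Torus D) :
    ∃ I : ℂ, Tendsto (fun z => oint fun ξ => f ξ * cauchyKernel σ z ξ)
      (𝓝[polydisk σ] (toC ζ)) (𝓝 I) := by
  have hfc := hf.continuous hr
  set ρ : Fin D → (Fin D → ℂ) → ℝ := fun i z => if i ∈ σ then ‖z i‖⁻¹ else ‖z i‖ with hρ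
  -- After the rotation z_i/ξ_i = |z_i| η_i⁻¹, and the geometric ratio is its inverse when i ∈ σ.
  set ε : Fin D → ℤ := fun i => if i ∈ σ then 1 else -1 with hε
  have hε1 : ∀ i, ε i = 1 ∨ ε i = -1 := fun i => by
    simp only [hε]
    split_ifs <;> simp
  set K : Fin D → (Fin D → ℂ) → Circle → ℂ := fun i z η =>
    geomKernel (orthantShift σ i) (ρ i z * (η : ℂ) ^ ε i) with hKdef
  have hlim : ∀ i, Tendsto (ρ i) (𝓝[polydisk σ] (toC ζ)) (𝓝 1) := fun i => by
    have h1 : Tendsto (fun z : Fin D → ℂ => ‖z i‖) (𝓝[polydisk σ] (toC ζ)) (𝓝 1) := by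
      have := ((continuous_apply i).norm : Continuous fun z : Fin D → ℂ => ‖z i‖).tendsto (toC ζ)
      rw [norm_toC] at this
      exact this.mono_left nhdsWithin_le_nhds
    simp only [hρ]
    split_ifs
    · simpa using h1.inv₀ one_ne_zero
    · exact h1
  have hK : ∀ᶠ z in 𝓝[polydisk σ] (toC ζ), ∀ i,
      IsCauchyType 2 (if orthantShift σ i = 0 then 2 * Real.pi else 0) (K i z) := by
    filter_upwards [self_mem_nhdsWithin] with z hz i
    refine isCauchyType_geomKernel _ ?_ ?_ (hε1 i)
    · simp only [hρ]
      split_ifs <;> positivity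
    · have := hz i
      simp only [hρ]
      split_ifs at this ⊢
      · exact inv_lt_one_of_one_lt₀ this
      · exact this
  obtain ⟨L, hL, -⟩ := exists_tendsto_integral_mul_prod D 2 _ K
    (fun i η => geomKernel (orthantShift σ i) ((η : ℂ) ^ ε i)) hK (fun i η hη => by
      have hne : (η : ℂ) ^ ε i ≠ 1 := by
        rcases hε1 i with h | h
        · simpa [h, Circle.coe_eq_one] using hη
        · simpa [h, Circle.coe_eq_one] using hη
      have h2 : Tendsto (fun z => (ρ i z : ℂ) * (η : ℂ) ^ ε i) (𝓝[polydisk σ] (toC ζ))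
          (𝓝 ((η : ℂ) ^ ε i)) := by
        simpa using ((Complex.continuous_ofReal.tendsto 1).comp (hlim i)).mul_const
          ((η : ℂ) ^ ε i)
      exact (geomKernel_continuousAt _ hne).tendsto.comp h2)
    r hr hr1 M (fun z η => f (unitPart z * η)) (fun η => f (ζ * η))
    (Eventually.of_forall fun z => hf.comp_mul_left _) fun η =>
      (hfc.tendsto _).comp (((tendsto_unitPart ζ).mono_left nhdsWithin_le_nhds).mul_const η)
  -- The correction from the missing term α = 0 is independent of z.
  refine ⟨_, (hL.sub_const (∫ ξ, f ξ * (if σ = Finset.univ then 1 else 0)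
    ∂torusMeasure D)).congr' ?_⟩
  have hne : ∀ᶠ z in 𝓝[polydisk σ] (toC ζ), ∀ i, z i ≠ 0 := by
    refine eventually_all.2 fun i => ?_
    have := ((continuous_apply i).tendsto (toC ζ)).eventually_ne (toC_ne_zero ζ i)
    exact this.filter_mono nhdsWithin_le_nhds
  filter_upwards [self_mem_nhdsWithin, hK, hne] with z hz hKz hz0
  rw [oint_eq_integral (f := fun ξ => f ξ * cauchyKernel σ z ξ)
    (hfc.mul (continuous_cauchyKernel hz)).aestronglyMeasurable]
  have hKc : Continuous fun η : Torus D => f (unitPart z * η) * ∏ i, K i z (η i) :=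
    (hfc.comp (continuous_const.mul continuous_id)).mul
      (continuous_finsetProd _ fun i _ => (hKz i).continuous.comp (continuous_apply i))
  have hconst : Continuous fun η : Torus D =>
      f (unitPart z * η) * (if σ = Finset.univ then (1 : ℂ) else 0) :=
    (hfc.comp (continuous_const.mul continuous_id)).mul continuous_const
  rw [← integral_mul_left_eq_self (fun ξ => f ξ * cauchyKernel σ z ξ) (unitPart z),
    ← integral_mul_left_eq_self
      (fun ξ : Torus D => f ξ * (if σ = Finset.univ then (1 : ℂ) else 0)) (unitPart z),
    ← integral_sub (integrable_torus_of_continuous hKc)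
      (integrable_torus_of_continuous hconst)]
  refine integral_congr_ae (Eventually.of_forall fun η => ?_)
  simp only [cauchyKernel_eq hz, ← mul_sub]
  congr 2
  refine Finset.prod_congr rfl fun i _ => ?_
  simp only [hKdef]
  congr 1
  have h1 := norm_mul_unitPart z i
  have h2 := toC_ne_zero (unitPart z) i
  have h3 : toC (unitPart z * η) i = toC (unitPart z) i * η i := rfl
  have h4 : (‖z i‖ : ℂ) ≠ 0 := by simpa using hz0 i
  have h5 : (η i : ℂ) ≠ 0 := Circle.coe_ne_zero (η i)
  rw [h3]
  generalize toC (unitPart z) i = u at *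
  simp only [hρ, hε, orthantRatio]
  split_ifs
  · rw [zpow_one, inv_div, Complex.ofReal_inv]
    generalize (‖z i‖ : ℂ) = t at *
    rw [← h1]
    field_simp
  · rw [zpow_neg_one]
    generalize (‖z i‖ : ℂ) = t at *
    rw [← h1]
    field_simp

/-! ### The integer orthants form a partition -/

section Partition

open scoped Fin.NatCast Fin.CommRing

variable {D : ℕ} [NeZero D]

/-- Reads membership as conditions on σ for fixed α: a nonzero coordinate decides its index, a zero
copies its cyclic successor. -/
theorem mem_orthant_iff_forall {σ : Finset (Fin D)} {α : Fin D → ℤ} (hα : α ≠ 0) :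
    α ∈ orthant σ ↔ ∀ i, (α i < 0 → i ∈ σ) ∧ (0 < α i → i ∉ σ) ∧
      (α i = 0 → (i ∈ σ ↔ i + 1 ∈ σ)) := by
  rw [mem_orthant_iff, and_iff_left fun _ => hα]
  refine forall_congr' fun i => ?_
  by_cases hi : i ∈ σ <;> by_cases hj : i + 1 ∈ σ <;>
    simp [orthantSide, orthantShift, hi, hj] <;> omega

/-- Each multi-index belongs to exactly one orthant: a vanishing coordinate takes the side of the
next non-vanishing one. -/
theorem existsUnique_mem_orthant (α : Fin D → ℤ) :
    ∃! σ : Finset (Fin D), α ∈ orthant σ := by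
  classical
  by_cases hα : α = 0
  -- For α = 0 membership in σ is constant along the cycle, and the full σ excludes the origin,
  -- leaving only ∅.
  · subst hα
    refine ⟨∅, mem_orthant_iff.2 ⟨fun i => by simp [orthantSide, orthantShift], fun h => ?_⟩,
      fun σ hσ => ?_⟩
    · exact absurd (h ▸ Finset.mem_univ (0 : Fin D)) (Finset.notMem_empty _)
    · obtain ⟨h1, h2⟩ := mem_orthant_iff.1 hσ
      have h3 : ∀ i, i ∈ σ ↔ i + 1 ∈ σ := fun i => by
        have := h1 i
        by_contra hne
        simp only [orthantSide, orthantShift, if_neg hne, Pi.zero_apply,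
          Set.mem_ofPred_eq] at this
        split_ifs at this <;> omega
      have h4 : ∀ n : ℕ, ((n : Fin D) ∈ σ ↔ (0 : Fin D) ∈ σ) := fun n => by
        induction n with
        | zero => simp
        | succ n ih => rw [Nat.cast_succ, ← h3, ih]
      by_contra hne
      obtain ⟨i, hi⟩ := Finset.nonempty_iff_ne_empty.2 hne
      refine h2 (Finset.eq_univ_iff_forall.2 fun j => ?_) rfl
      rw [← Fin.cast_val_eq_self j, h4, ← h4 i, Fin.cast_val_eq_self]
      exact hi
  · obtain ⟨j, hj⟩ := Function.ne_iff.1 hα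
    have hex : ∀ i : Fin D, ∃ k : ℕ, α (i + k) ≠ 0 := fun i => by
      refine ⟨(j - i : Fin D).val, ?_⟩
      rw [Fin.cast_val_eq_self, add_sub_cancel]
      exact hj
    simp only [mem_orthant_iff_forall hα]
    refine ⟨Finset.univ.filter fun i => α (i + (Nat.find (hex i) : ℕ)) < 0, fun i => ?_,
      fun σ hσ => ?_⟩
    · simp only [Finset.mem_filter, Finset.mem_univ, true_and]
      have hz : α i ≠ 0 → Nat.find (hex i) = 0 := fun h => by
        rw [Nat.find_eq_zero]
        simpa using h
      refine ⟨fun h => ?_, fun h => ?_, fun h => ?_⟩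
      · rw [hz h.ne]
        simpa using h
      · rw [hz h.ne']
        simpa using h.le
      · have hs : Nat.find (hex i) = Nat.find (hex (i + 1)) + 1 := by
          rw [Nat.find_eq_iff]
          refine ⟨?_, fun n hn => ?_⟩
          · have := Nat.find_spec (hex (i + 1))
            rwa [Nat.cast_succ, add_comm (_ : Fin D) 1, ← add_assoc]
          · cases n with
            | zero => simpa using h
            | succ n =>
              have := Nat.find_min (hex (i + 1)) (Nat.lt_of_succ_lt_succ hn)
              rwa [Nat.cast_succ, add_comm (_ : Fin D) 1, ← add_assoc]
        rw [hs, Nat.cast_succ, add_comm (_ : Fin D) 1, ← add_assoc]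
    -- Uniqueness by induction on the cyclic distance to the next nonzero coordinate.
    · have key : ∀ k : ℕ, ∀ i : Fin D, (∀ m < k, α (i + m) = 0) → α (i + k) ≠ 0 →
          (i ∈ σ ↔ α (i + k) < 0) := by
        intro k
        induction k with
        | zero =>
          intro i _ hi
          rw [Nat.cast_zero, add_zero] at hi ⊢
          exact ⟨fun h => lt_of_le_of_ne (not_lt.1 fun h' => (hσ i).2.1 h' h) hi, (hσ i).1⟩
        | succ k ih =>
          intro i h0 hi
          have e : ∀ m : ℕ, i + ((m + 1 : ℕ) : Fin D) = i + 1 + m := fun m => by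
            rw [Nat.cast_succ, add_comm (m : Fin D) 1, ← add_assoc]
          rw [e] at hi ⊢
          have h00 := h0 0 (Nat.succ_pos k)
          rw [Nat.cast_zero, add_zero] at h00
          rw [(hσ i).2.2 h00]
          exact ih (i + 1) (fun m hm => by rw [← e]; exact h0 _ (Nat.succ_lt_succ hm)) hi
      ext i
      rw [Finset.mem_filter, and_iff_right (Finset.mem_univ i)]
      exact key _ i (fun m hm => not_not.1 (Nat.find_min (hex i) hm)) (Nat.find_spec (hex i))

end Partition

/-! ### The sum over all orthants is a Poisson integral -/

/-- The Poisson kernel `∑ₙ ρ^|n| wⁿ`. -/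
def poissonSum (ρ : ℝ) (w : ℂ) : ℂ := geomKernel 0 (ρ * w) + geomKernel 1 (ρ * w⁻¹)

theorem hasSum_poissonSum {ρ : ℝ} (h0 : 0 ≤ ρ) (h1 : ρ < 1) {w : ℂ} (hw : ‖w‖ = 1) :
    HasSum (fun n : ℤ => (ρ : ℂ) ^ n.natAbs * w ^ n) (poissonSum ρ w) := by
  have hn : ‖(ρ : ℂ) * w‖ < 1 := by
    rw [norm_mul, hw, mul_one, Complex.norm_of_nonneg h0]
    exact h1
  have hn' : ‖(ρ : ℂ) * w⁻¹‖ < 1 := by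
    rw [norm_mul, norm_inv, hw, inv_one, mul_one, Complex.norm_of_nonneg h0]
    exact h1
  refine HasSum.of_nat_of_neg_add_one ?_ ?_
  · convert! hasSum_geomKernel hn 0 using 2 with n
    rw [Int.natAbs_natCast, zpow_natCast, add_zero, mul_pow]
  · convert! hasSum_geomKernel hn' 1 using 2 with n
    have e : (-((n : ℤ) + 1)).natAbs = n + 1 := by omega
    rw [e, zpow_neg, mul_pow, inv_pow]
    norm_cast

/-- The point of the polydisk of `σ` at the radial position `ρ` below or above `ζ`. -/
def radialPoint {D : ℕ} (ρ : ℝ) (ζ : Torus D) (σ : Finset (Fin D)) : Fin D → ℂ := fun i =>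
  if i ∈ σ then (ρ : ℂ)⁻¹ * toC ζ i else ρ * toC ζ i

theorem radialPoint_mem {D : ℕ} {ρ : ℝ} (h0 : 0 < ρ) (h1 : ρ < 1) (ζ : Torus D)
    (σ : Finset (Fin D)) : radialPoint ρ ζ σ ∈ polydisk σ := by
  intro i
  unfold radialPoint
  split_ifs
  · rw [norm_mul, norm_toC, mul_one, norm_inv, Complex.norm_of_nonneg h0.le]
    exact (one_lt_inv₀ h0).2 h1
  · rw [norm_mul, norm_toC, mul_one, Complex.norm_of_nonneg h0.le]
    exact h1

theorem tendsto_radialPoint {D : ℕ} (ζ : Torus D) (σ : Finset (Fin D)) :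
    Tendsto (fun ρ => radialPoint ρ ζ σ) (𝓝[<] 1) (𝓝[polydisk σ] (toC ζ)) := by
  refine tendsto_nhdsWithin_iff.2 ⟨?_, ?_⟩
  · refine tendsto_pi_nhds.2 fun i => ?_
    have h : Tendsto (fun ρ : ℝ => (ρ : ℂ)) (𝓝[<] 1) (𝓝 1) := by
      have := Complex.continuous_ofReal.tendsto 1
      rw [Complex.ofReal_one] at this
      exact this.mono_left nhdsWithin_le_nhds
    unfold radialPoint
    split_ifs
    · simpa using (h.inv₀ one_ne_zero).mul_const (toC ζ i)
    · simpa using h.mul_const (toC ζ i)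
  · filter_upwards [Ioo_mem_nhdsLT (zero_lt_one (α := ℝ))] with ρ hρ
    exact radialPoint_mem hρ.1 hρ.2 ζ σ

/-- On the orthant of σ the radial point gives z^α = ρ^|α| ζ^α, since exponents are ≤ 0 exactly
where the radius is inverted. As each α lies in one orthant, the kernels add up to the full Poisson
series. -/
theorem sum_cauchyKernel_radialPoint {D : ℕ} [NeZero D] {ρ : ℝ} (h0 : 0 < ρ) (h1 : ρ < 1)
    (ζ ξ : Torus D) : ∑ σ : Finset (Fin D), cauchyKernel σ (radialPoint ρ ζ σ) ξ =
      ∏ i, poissonSum ρ (toC ζ i / toC ξ i) := by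
  classical
  have hw : ∀ i, ‖toC ζ i / toC ξ i‖ = 1 := fun i => by
    rw [norm_div, norm_toC, norm_toC, div_one]
  have hP := fun i => hasSum_poissonSum h0.le h1 (hw i)
  have hprod := (hasSum_prod_apply D _ fun i => (hP i).summable.norm).2
  simp only [fun i => (hP i).tsum_eq] at hprod
  have hsum := hasSum_sum (s := (Finset.univ : Finset (Finset (Fin D)))) fun σ _ =>
    (hasSum_cauchyKernel (radialPoint_mem h0 h1 ζ σ) ξ).2
  simp only [← cauchyKernel_eq (radialPoint_mem h0 h1 ζ _)] at hsum
  refine hsum.unique ?_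
  convert! hprod using 2 with α
  obtain ⟨σ, hσ, huniq⟩ := existsUnique_mem_orthant α
  rw [Finset.sum_eq_single σ]
  · rw [conj_mono_mul_chiOrthant, Set.indicator_of_mem hσ]
    refine Finset.prod_congr rfl fun i _ => ?_
    have hside := (mem_orthant_iff.1 hσ).1 i
    simp only [orthantSide, Set.mem_ofPred_eq] at hside
    unfold radialPoint
    split_ifs at hside ⊢
    · obtain ⟨n, hn⟩ : ∃ n : ℕ, α i = -n := ⟨(-α i).toNat, by omega⟩
      rw [hn, Int.natAbs_neg, Int.natAbs_natCast, mul_div_assoc, mul_zpow, inv_zpow, zpow_neg,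
        inv_inv, zpow_natCast]
    · obtain ⟨n, hn⟩ : ∃ n : ℕ, α i = n := ⟨(α i).toNat, by omega⟩
      rw [hn, Int.natAbs_natCast, mul_div_assoc, mul_zpow, zpow_natCast]
  · intro τ _ hτ
    rw [conj_mono_mul_chiOrthant, Set.indicator_of_notMem fun h => hτ (huniq τ h)]
  · simp

theorem IsCauchyType.add {C C' : ℝ} {c c' : ℂ} {K K' : Circle → ℂ} (h : IsCauchyType C c K)
    (h' : IsCauchyType C' c' K') : IsCauchyType (C + C') (c + c') fun η => K η + K' η where
  continuous := h.continuous.add h'.continuous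
  norm_mul_dist_le η := by
    have := mul_le_mul_of_nonneg_right (norm_add_le (K η) (K' η)) (dist_nonneg (x := η) (y := 1))
    linarith [h.norm_mul_dist_le η, h'.norm_mul_dist_le η]
  integral_eq := by
    rw [integral_add, h.integral_eq, h'.integral_eq]
    · exact h.continuous.integrable_of_hasCompactSupport (HasCompactSupport.of_compactSpace _)
    · exact h'.continuous.integrable_of_hasCompactSupport (HasCompactSupport.of_compactSpace _)

theorem isCauchyType_poissonSum {ρ : ℝ} (h0 : 0 ≤ ρ) (h1 : ρ < 1) :
    IsCauchyType 4 (2 * Real.pi) fun η : Circle => poissonSum ρ (η : ℂ)⁻¹ := by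
  have := (isCauchyType_geomKernel 0 h0 h1 (Or.inr rfl)).add
    (isCauchyType_geomKernel 1 h0 h1 (Or.inl rfl))
  norm_num at this
  simpa [poissonSum] using this

/-- At ρ = 1 the two geometric sums cancel: 1/(1 - η⁻¹) + η/(1 - η) = 0. -/
theorem tendsto_poissonSum {η : Circle} (hη : η ≠ 1) :
    Tendsto (fun ρ : ℝ => poissonSum ρ (η : ℂ)⁻¹) (𝓝[<] 1) (𝓝 0) := by
  have h1 : (η : ℂ) ≠ 1 := fun h => hη (Circle.coe_eq_one.1 h)
  have h2 : (η : ℂ)⁻¹ ≠ 1 := by rwa [Ne, inv_eq_one]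
  have hlim : ∀ w : ℂ, Tendsto (fun ρ : ℝ => (ρ : ℂ) * w) (𝓝[<] 1) (𝓝 w) := fun w => by
    have := ((Complex.continuous_ofReal.tendsto 1).mono_left
      (nhdsWithin_le_nhds (s := Set.Iio 1))).mul_const w
    simpa using this
  have h := ((geomKernel_continuousAt 0 h2).tendsto.comp (hlim _)).add
    ((geomKernel_continuousAt 1 h1).tendsto.comp (hlim _))
  have e : geomKernel 0 (η : ℂ)⁻¹ + geomKernel 1 (η : ℂ) = 0 := by
    have h3 : (η : ℂ) ≠ 0 := Circle.coe_ne_zero η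
    have h4 : (1 : ℂ) - η ≠ 0 := sub_ne_zero.2 h1.symm
    have h5 : (1 : ℂ) - (η : ℂ)⁻¹ = -((1 - η) / η) := by
      field_simp
      ring
    rw [geomKernel, geomKernel, h5]
    field_simp
    ring
  rw [e] at h
  simpa [poissonSum, Function.comp_def] using h

/-- The kernels vanish in the limit off 1, so the limit lemma leaves only the product of the masses
2π times the value at η = 1. -/
theorem tendsto_sum_cauchyIntegral {D : ℕ} [NeZero D] {M r : ℝ} (hr : 0 < r) (hr1 : r ≤ 1)
    {f : Torus D → ℂ} (hf : IsHolderBounded M r f) (ζ : Torus D) :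
    Tendsto (fun ρ => ∑ σ : Finset (Fin D),
      oint fun ξ => f ξ * cauchyKernel σ (radialPoint ρ ζ σ) ξ) (𝓝[<] 1)
      (𝓝 ((2 * Real.pi : ℂ) ^ D * f ζ)) := by
  have hfc := hf.continuous hr
  have hIoo : Set.Ioo (0 : ℝ) 1 ∈ 𝓝[<] (1 : ℝ) := Ioo_mem_nhdsLT zero_lt_one
  obtain ⟨L, hL, hzero⟩ := exists_tendsto_integral_mul_prod (l := 𝓝[<] (1 : ℝ)) D 4
    (fun _ => 2 * Real.pi) (fun _ ρ η => poissonSum ρ (η : ℂ)⁻¹) (fun _ _ => 0)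
    (by filter_upwards [hIoo] with ρ hρ i using isCauchyType_poissonSum hρ.1.le hρ.2)
    (fun _ η hη => tendsto_poissonSum hη) r hr hr1 M (fun _ η => f (ζ * η)) (fun η => f (ζ * η))
    (Eventually.of_forall fun _ => hf.comp_mul_left ζ) fun _ => tendsto_const_nhds
  have hLval : L = (2 * Real.pi : ℂ) ^ D * f ζ := by
    rw [hzero fun _ _ _ => rfl]
    simp
  rw [← hLval]
  refine hL.congr' ?_
  filter_upwards [hIoo] with ρ hρ
  have hint : ∀ σ : Finset (Fin D), Continuous
      fun ξ => f ξ * cauchyKernel σ (radialPoint ρ ζ σ) ξ := fun σ =>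
    hfc.mul (continuous_cauchyKernel (radialPoint_mem hρ.1 hρ.2 ζ σ))
  simp only [fun σ => oint_eq_integral (hint σ).aestronglyMeasurable]
  rw [← integral_finsetSum _ fun σ _ => integrable_torus_of_continuous (hint σ)]
  simp only [← Finset.mul_sum, sum_cauchyKernel_radialPoint hρ.1 hρ.2]
  rw [← integral_mul_left_eq_self (fun ξ => f ξ * ∏ i, poissonSum ρ (toC ζ i / toC ξ i)) ζ]
  refine integral_congr_ae (Eventually.of_forall fun η => ?_)
  refine congrArg (f (ζ * η) * ·) (Finset.prod_congr rfl fun i _ => congrArg (poissonSum ρ) ?_)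
  have h3 : toC (ζ * η) i = toC ζ i * η i := rfl
  rw [h3, div_mul_eq_div_div, div_self (toC_ne_zero ζ i), one_div]

/-! ### Holomorphy of the orthant extensions -/

/-- Differentiation under the integral sign over a compact parameter space. -/
theorem differentiableOn_integral {E X : Type*} [NormedAddCommGroup E] [NormedSpace ℂ E]
    [FiniteDimensional ℂ E] [TopologicalSpace X] [CompactSpace X]
    [TopologicalSpace.PseudoMetrizableSpace X] [MeasurableSpace X] [OpensMeasurableSpace X] {μ : Measure X}
    [IsFiniteMeasure μ] {U : Set E} (hU : IsOpen U) {F : E → X → ℂ} {F' : E → X → E →L[ℂ] ℂ}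
    (hF : ∀ z ∈ U, Continuous (F z)) (hF' : ∀ z ∈ U, ∀ x, HasFDerivAt (fun z => F z x) (F' z x) z)
    (hF'c : ContinuousOn (fun p : E × X => F' p.1 p.2) (U ×ˢ Set.univ)) :
    DifferentiableOn ℂ (fun z => ∫ x, F z x ∂μ) U := by
  intro z hz
  have : ProperSpace E := FiniteDimensional.proper ℂ E
  obtain ⟨δ, hδ, hsub⟩ := Metric.nhds_basis_closedBall.mem_iff.1 (hU.mem_nhds hz)
  -- Joint continuity on a compact product gives a constant dominating function.
  obtain ⟨B, hB⟩ := ((isCompact_closedBall z δ).prod isCompact_univ).exists_bound_of_continuousOn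
    (hF'c.mono (Set.prod_mono hsub subset_rfl))
  have hcz : Continuous (F' z) := by
    rw [← continuousOn_univ]
    exact hF'c.comp (f := fun x => (z, x)) (by fun_prop) fun x hx => ⟨hz, hx⟩
  refine (hasFDerivAt_integral_of_dominated_of_fderiv_le (F' := F') (bound := fun _ => B)
    (Metric.closedBall_mem_nhds z hδ) ?_ ?_ ?_ ?_ (integrable_const _)
    ?_).differentiableAt.differentiableWithinAt
  · filter_upwards [hU.mem_nhds hz] with w hw using (hF w hw).aestronglyMeasurable
  · exact (hF z hz).integrable_of_hasCompactSupport (HasCompactSupport.of_compactSpace _)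
  · exact hcz.aestronglyMeasurable
  · exact Eventually.of_forall fun x w hw => hB (w, x) ⟨hw, trivial⟩
  · exact Eventually.of_forall fun x w hw => hF' w (hsub hw) x

/-- The domain of the `i`-th variable in the polydisk of `σ`. -/
def polydiskSide {D : ℕ} (σ : Finset (Fin D)) (i : Fin D) : Set ℂ :=
  {u | if i ∈ σ then 1 < ‖u‖ else ‖u‖ < 1}

theorem isOpen_polydiskSide {D : ℕ} (σ : Finset (Fin D)) (i : Fin D) :
    IsOpen (polydiskSide σ i) := by
  unfold polydiskSide
  split_ifs
  · exact isOpen_lt continuous_const continuous_norm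
  · exact isOpen_lt continuous_norm continuous_const

theorem isOpen_polydisk {D : ℕ} (σ : Finset (Fin D)) : IsOpen (polydisk σ) := by
  have : polydisk σ = ⋂ i, (fun z : Fin D → ℂ => z i) ⁻¹' polydiskSide σ i := by
    ext z
    simp [polydisk, polydiskSide]
  rw [this]
  exact isOpen_iInter_of_finite fun i => (isOpen_polydiskSide σ i).preimage (continuous_apply i)

theorem div_toC_mem_polydiskSide {D : ℕ} {σ : Finset (Fin D)} {z : Fin D → ℂ}
    (hz : z ∈ polydisk σ) (ξ : Torus D) (i : Fin D) : z i / toC ξ i ∈ polydiskSide σ i := by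
  have h : ‖z i / toC ξ i‖ = ‖z i‖ := by rw [norm_div, norm_toC, div_one]
  simp only [polydiskSide, Set.mem_ofPred_eq, h]
  exact hz i

theorem differentiableOn_geomKernel_orthantRatio {D : ℕ} (σ : Finset (Fin D)) (i : Fin D)
    (e : ℕ) : DifferentiableOn ℂ (fun u => geomKernel e (orthantRatio σ i u))
      (polydiskSide σ i) := by
  intro u hu
  have hlt : ‖orthantRatio σ i u‖ < 1 := by
    simp only [polydiskSide, Set.mem_ofPred_eq] at hu
    unfold orthantRatio
    split_ifs at hu ⊢
    · rw [norm_inv]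
      exact inv_lt_one_of_one_lt₀ hu
    · exact hu
  have hne : 1 - orthantRatio σ i u ≠ 0 := fun h => by
    rw [← sub_eq_zero.1 h, norm_one] at hlt
    exact lt_irrefl _ hlt
  have hr : DifferentiableAt ℂ (orthantRatio σ i) u := by
    simp only [polydiskSide, Set.mem_ofPred_eq] at hu
    unfold orthantRatio
    split_ifs at hu ⊢
    · exact differentiableAt_inv (norm_pos_iff.1 (zero_lt_one.trans hu))
    · exact differentiableAt_id
  exact ((hr.pow e).div ((differentiableAt_const 1).sub hr) hne).differentiableWithinAt

/-- In the Cauchy integral the kernel is, up to a constant, a product of holomorphic functions of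
z_i/ξ_i, so its z-derivative is jointly continuous in z and ξ. -/
theorem differentiableOn_orthantExtension {D : ℕ} [NeZero D] {f : Torus D → ℂ}
    (hf : Continuous f) (σ : Finset (Fin D)) :
    DifferentiableOn ℂ (orthantExtension f σ) (polydisk σ) := by
  classical
  set g : Fin D → ℂ → ℂ := fun i u => geomKernel (orthantShift σ i) (orthantRatio σ i u) with hg
  have hgd : ∀ i, DifferentiableOn ℂ (g i) (polydiskSide σ i) := fun i =>
    differentiableOn_geomKernel_orthantRatio σ i _
  have hderiv : ∀ z ∈ polydisk σ, ∀ ξ : Torus D,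
      HasFDerivAt (fun z : Fin D → ℂ => f ξ * cauchyKernel σ z ξ)
      (f ξ • ∑ i, (∏ j ∈ Finset.univ.erase i, g j (z j / toC ξ j)) •
        (deriv (g i) (z i / toC ξ i) / toC ξ i) •
          (ContinuousLinearMap.proj i : (Fin D → ℂ) →L[ℂ] ℂ)) z := by
    intro z hz ξ
    have h1 : ∀ i, HasFDerivAt (fun z : Fin D → ℂ => g i (z i / toC ξ i))
        ((deriv (g i) (z i / toC ξ i) / toC ξ i) •
          (ContinuousLinearMap.proj i : (Fin D → ℂ) →L[ℂ] ℂ)) z := fun i => by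
      have hd := ((hgd i).differentiableAt ((isOpen_polydiskSide σ i).mem_nhds
        (div_toC_mem_polydiskSide hz ξ i))).hasDerivAt
      have hd' := hd.comp (z i) ((hasDerivAt_id (z i)).div_const (toC ξ i))
      rw [mul_one_div] at hd'
      exact hd'.comp_hasFDerivAt z (ContinuousLinearMap.proj i : (Fin D → ℂ) →L[ℂ] ℂ).hasFDerivAt
    have h2 := ((HasFDerivAt.finsetProd (u := Finset.univ) fun i _ => h1 i).sub_const
      (if σ = Finset.univ then 1 else 0)).const_mul (f ξ)
    refine h2.congr_of_eventuallyEq ?_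
    filter_upwards [(isOpen_polydisk σ).mem_nhds hz] with w hw
    rw [cauchyKernel_eq hw]
  have hdiff := differentiableOn_integral (μ := torusMeasure D) (isOpen_polydisk σ)
    (fun z hz => hf.mul (continuous_cauchyKernel hz)) hderiv (by
      have hu : ∀ i, ContinuousOn (fun p : (Fin D → ℂ) × Torus D => p.1 i / toC p.2 i)
          (polydisk σ ×ˢ Set.univ) := fun i =>
        (((continuous_apply i).comp continuous_fst).div
          ((continuous_toC_apply i).comp continuous_snd) fun p =>
            toC_ne_zero p.2 i).continuousOn
      have hmaps : ∀ i, Set.MapsTo (fun p : (Fin D → ℂ) × Torus D => p.1 i / toC p.2 i)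
          (polydisk σ ×ˢ Set.univ) (polydiskSide σ i) := fun i p hp =>
        div_toC_mem_polydiskSide hp.1 p.2 i
      refine (hf.comp continuous_snd).continuousOn.smul
        (continuousOn_finsetSum _ fun i _ => ContinuousOn.fun_smul ?_ (ContinuousOn.fun_smul ?_
          continuousOn_const))
      · exact continuousOn_finsetProd _ fun j _ => (hgd j).continuousOn.comp (hu j) (hmaps j)
      · exact (((hgd i).deriv (isOpen_polydiskSide σ i)).continuousOn.comp (hu i) (hmaps i)).div
          ((continuous_toC_apply i).comp continuous_snd).continuousOn fun p _ =>
            toC_ne_zero p.2 i)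
  refine (hdiff.const_mul ((2 * Real.pi : ℂ) ^ D)⁻¹).congr fun z hz => ?_
  rw [orthantExtension_eq hf hz, oint_eq_integral (f := fun ξ => f ξ * cauchyKernel σ z ξ)
    (hf.mul (continuous_cauchyKernel hz)).aestronglyMeasurable]
  rfl

/-! ### The Plemelj formulae for a Hölder continuous function -/

theorem exists_isHolderBounded {D : ℕ} {C r : ℝ≥0} (hr : 0 < r) {f : Torus D → ℂ}
    (hf : HolderWith C r f) : ∃ M : ℝ, IsHolderBounded M r f := by
  obtain ⟨B, hB⟩ := (isCompact_univ (X := Torus D)).exists_bound_of_continuousOn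
    (hf.continuous hr).continuousOn
  refine ⟨max B C, fun x => (hB x trivial).trans (le_max_left _ _), fun x y => ?_⟩
  rw [← dist_eq_norm]
  exact (hf.dist_le x y).trans (mul_le_mul_of_nonneg_right (le_max_right _ _) (by positivity))

theorem plemelj_formulae {D : ℕ} [NeZero D] {C r : ℝ≥0} (hr0 : 0 < r) (hr1 : r < 1)
    {f : Torus D → ℂ} (hf : HolderWith C r f) :
    ∃ I B : Finset (Fin D) → Torus D → ℂ,
      (∀ σ ζ, Tendsto (fun z => oint fun ξ => f ξ * cauchyKernel σ z ξ)
        (𝓝[polydisk σ] (toC ζ)) (𝓝 (I σ ζ))) ∧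
      (∀ σ, DifferentiableOn ℂ (orthantExtension f σ) (polydisk σ)) ∧
      (∀ σ ζ, Tendsto (orthantExtension f σ) (𝓝[polydisk σ] (toC ζ)) (𝓝 (B σ ζ))) ∧
      (∀ σ ζ, I σ ζ + I σᶜ ζ = (2 * Real.pi : ℂ) ^ D * (B σ ζ + B σᶜ ζ)) ∧
      (∀ ζ, ∑ σ, I σ ζ = (2 * Real.pi : ℂ) ^ D * f ζ) := by
  obtain ⟨M, hM⟩ := exists_isHolderBounded hr0 hf
  have hfc := hf.continuous hr0
  choose I hI using exists_tendsto_cauchyIntegral (NNReal.coe_pos.2 hr0)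
    (NNReal.coe_le_one.2 hr1.le) hM
  refine ⟨I, fun σ ζ => ((2 * Real.pi : ℂ) ^ D)⁻¹ * I σ ζ, hI,
    differentiableOn_orthantExtension hfc, fun σ ζ => ?_, fun σ ζ => ?_, fun ζ => ?_⟩
  · refine ((hI σ ζ).const_mul _).congr' ?_
    filter_upwards [self_mem_nhdsWithin] with z hz using (orthantExtension_eq hfc hz).symm
  · have h : (2 * Real.pi : ℂ) ^ D ≠ 0 := pow_ne_zero _ (by simp [Real.pi_ne_zero])
    rw [← mul_add, mul_inv_cancel_left₀ h]
  -- The unrestricted limits agree with those along radial points, where the sum is known.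
  · exact tendsto_nhds_unique
      (tendsto_finsetSum _ fun σ _ => (hI σ ζ).comp (tendsto_radialPoint ζ σ))
      (tendsto_sum_cauchyIntegral (NNReal.coe_pos.2 hr0) (NNReal.coe_le_one.2 hr1.le) hM ζ)

end

end MVOLPUT

/-! ### The formulae for the biorthogonal Laurent polynomials -/

open MVOLPUT in
theorem mainTheorem7 (D : ℕ) [NeZero D] (w : Torus D → ℂ) (hw : IsDensity w)
    (hG : IsQuasiDefinite (momentMatrix w)) (α : Fin D → ℤ)
    (r C Ch : ℝ≥0) (hr0 : 0 < r) (hr1 : r < 1)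
    (hPhi : HolderWith C r fun ζ : Torus D => Phi hG α (toC ζ) * w ζ)
    (hPhiHat : HolderWith Ch r fun ζ : Torus D => PhiHat hG α (toC ζ) * conj (w ζ)) :
    -- the formulae for the hatted polynomial: `I σ ζ` is the boundary limit of the integral
    -- transform and `B σ ζ` is the boundary value of the orthant extension
    (∃ I B : Finset (Fin D) → Torus D → ℂ,
      (∀ σ ζ, Tendsto
        (fun z => oint fun ξ => PhiHat hG α (toC ξ) * cauchyKernel σ z ξ * conj (w ξ))
        (𝓝[polydisk σ] (toC ζ)) (𝓝 (I σ ζ))) ∧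
      (∀ σ, DifferentiableOn ℂ
        (orthantExtension (fun ξ => PhiHat hG α (toC ξ) * conj (w ξ)) σ) (polydisk σ)) ∧
      (∀ σ ζ, Tendsto
        (orthantExtension (fun ξ => PhiHat hG α (toC ξ) * conj (w ξ)) σ)
        (𝓝[polydisk σ] (toC ζ)) (𝓝 (B σ ζ))) ∧
      (∀ σ ζ, I σ ζ + I σᶜ ζ = (2 * Real.pi : ℂ) ^ D * (B σ ζ + B σᶜ ζ)) ∧
      (∀ ζ, ∑ σ, I σ ζ = (2 * Real.pi : ℂ) ^ D * (PhiHat hG α (toC ζ) * conj (w ζ)))) ∧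
    -- the formulae for the unhatted polynomial
    (∃ I B : Finset (Fin D) → Torus D → ℂ,
      (∀ σ ζ, Tendsto
        (fun z => oint fun ξ => Phi hG α (toC ξ) * cauchyKernel σ z ξ * w ξ)
        (𝓝[polydisk σ] (toC ζ)) (𝓝 (I σ ζ))) ∧
      (∀ σ, DifferentiableOn ℂ
        (orthantExtension (fun ξ => Phi hG α (toC ξ) * w ξ) σ) (polydisk σ)) ∧
      (∀ σ ζ, Tendsto
        (orthantExtension (fun ξ => Phi hG α (toC ξ) * w ξ) σ)
        (𝓝[polydisk σ] (toC ζ)) (𝓝 (B σ ζ))) ∧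
      (∀ σ ζ, I σ ζ + I σᶜ ζ = (2 * Real.pi : ℂ) ^ D * (B σ ζ + B σᶜ ζ)) ∧
      (∀ ζ, ∑ σ, I σ ζ = (2 * Real.pi : ℂ) ^ D * (Phi hG α (toC ζ) * w ζ))) := by
  -- Moves the density next to the polynomial, so that their product plays the role of the Hölder
  -- function.
  have hassoc : ∀ (g v : Torus D → ℂ) (σ : Finset (Fin D)) (z : Fin D → ℂ),
      (oint fun ξ => g ξ * cauchyKernel σ z ξ * v ξ) =
        oint fun ξ => g ξ * v ξ * cauchyKernel σ z ξ := fun g v σ z =>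
    congrArg oint (funext fun ξ => mul_right_comm _ _ _)
  simp only [hassoc (fun ξ => PhiHat hG α (toC ξ)) fun ξ => conj (w ξ),
    hassoc (fun ξ => Phi hG α (toC ξ)) w]
  exact ⟨plemelj_formulae hr0 hr1 hPhiHat, plemelj_formulae hr0 hr1 hPhi⟩
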